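/- Let $F_2$ be the free group with basis $\{a,b\}$. The cyclic word $[v]$ of $v\in F_2$ is the set of cyclic permutations of a cyclically reduced word conjugate to $v$, and $\|v\|$ is its length. An element of $F_2$, or a cyclic word, is positive if its reduced word (respectively, the cyclic word) contains no letter $a^{-1}$ or $b^{-1}$; an element $u$ is potentially positive if $\phi(u)$ is positive for some automorphism $\phi$ of $F_2$. Let $\sigma,\tau$ be the automorphisms of $F_2$ with $\sigma(a)=ab$, $\sigma(b)=b$ and $\tau(a)=a$, $\tau(b)=ba$. A chain of type (C1) is an automorphism $\tau^{m_k}\sigma^{l_k}\cdots\tau^{m_1}\sigma^{l_1}$, and a chain of type (C2) is an automorphism $\tau^{-m_k}\sigma^{-l_k}\cdots\tau^{-m_1}\sigma^{-l_1}$, with all $l_i,m_i\ge 0$; here products are compositions with the rightmost factor applied first, and the length of the chain is $\sum_{i=1}^k(m_i+l_i)$. An automorphism $\beta$ of $F_2$ is of type (W1) if it permutes $\{a,b,a^{-1},b^{-1}\}$. Theorem. Let $u\in F_2$, and let $\Omega$ be the set of all chains of type (C1) or (C2) of length at most $2\|u\|+3$. The set $\Omega$ and the set of automorphisms of type (W1)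 are finite. Suppose that the cyclic word $[\phi(u)]$ is positive for some automorphism $\phi$ of $F_2$. Then there exist $\psi\in\Omega$ and an automorphism $\beta$ of type (W1) such that the cyclic word $[\beta\psi(u)]$ is positive. (For all $\psi\in\Omega$ and $\beta$ of type (W1), $[\beta\psi(u)]$ is positive if and only if there is $c\in F_2$ such that $\pi_c\beta\psi(u)$ is positive, where $\pi_c$ is the inner automorphism induced by $c$.) Consequently, $u$ is potentially positive if and only if $[\beta\psi(u)]$ is positive for some $\psi\in\Omega$ and some $\beta$ of type (W1), and there is an algorithm that decides, given a word in $a^{\pm1},b^{\pm1}$, whether the element of $F_2$ that it represents is potentially positive. -/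

import Mathlib

/-- The free group with basis `a = FreeGroup.of 0`, `b = FreeGroup.of 1`. -/
abbrev F2 : Type := FreeGroup (Fin 2)

namespace F2

/-- The basis element `a`. -/
def a : F2 := FreeGroup.of 0

/-- The basis element `b`. -/
def b : F2 := FreeGroup.of 1

/-- The set of letters `{a, b, a⁻¹, b⁻¹}`. -/
def letters : Set F2 := {a, b, a⁻¹, b⁻¹}

/-- A cyclic word: a word (a list of letters `(i, ε)`, where `ε = true` stands for the exponent `1`
and `ε = false` for the exponent `-1`) up to cyclic permutation. -/
abbrev CyclicWord : Type := Cycle (Fin 2 × Bool)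

/-- The cyclic word `[u]`: the cyclic permutations of a cyclically reduced word conjugate
to `u`. -/
def cyclicWord (u : F2) : CyclicWord :=
  (FreeGroup.reduceCyclically u.toWord : List (Fin 2 × Bool))

/-- The cyclic length `‖u‖`. -/
def cyclicLength (u : F2) : ℕ := (cyclicWord u).length

/-- An element is positive if its reduced word has no negative exponents. -/
def IsPositive (u : F2) : Prop := ∀ x ∈ u.toWord, x.2 = true

/-- A cyclic word is positive if it has no negative exponents. -/
def CyclicWord.IsPositive (w : CyclicWord) : Prop := ∀ x ∈ w, x.2 = true

/-- `u` is potentially positive if some automorphism takes it to a positive element. -/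
def IsPotentiallyPositive (u : F2) : Prop := ∃ φ : MulAut F2, IsPositive (φ u)

/-- A Whitehead automorphism of type (W1): it permutes the letters `a, b, a⁻¹, b⁻¹`. -/
def IsW1 (β : MulAut F2) : Prop := Set.BijOn β letters letters

/-- The Whitehead automorphism `σ = ({a}, b)`: `a ↦ a b`, `b ↦ b`. -/
def σ : MulAut F2 :=
  MonoidHom.toMulEquiv
    (FreeGroup.lift ![a * b, b])
    (FreeGroup.lift ![a * b⁻¹, b])
    (by ext i; fin_cases i <;> simp [a, b])
    (by ext i; fin_cases i <;> simp [a, b])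

/-- The Whitehead automorphism `τ = ({b}, a)`: `a ↦ a`, `b ↦ b a`. -/
def τ : MulAut F2 :=
  MonoidHom.toMulEquiv
    (FreeGroup.lift ![a, b * a])
    (FreeGroup.lift ![a, b * a⁻¹])
    (by ext i; fin_cases i <;> simp [a, b])
    (by ext i; fin_cases i <;> simp [a, b])

/-- The chain `τ ^ m_k σ ^ l_k ⋯ τ ^ m_1 σ ^ l_1` of type (C1), for the list of exponents
`[(m_k, l_k), …, (m_1, l_1)]`. The product of `MulAut` is composition, so that `σ ^ l_1` is
applied first. -/
def chainC1 (e : List (ℕ × ℕ)) : MulAut F2 := (e.map fun p => τ ^ p.1 * σ ^ p.2).prod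

/-- The chain `τ ^ (-m_k) σ ^ (-l_k) ⋯ τ ^ (-m_1) σ ^ (-l_1)` of type (C2). -/
def chainC2 (e : List (ℕ × ℕ)) : MulAut F2 := (e.map fun p => τ⁻¹ ^ p.1 * σ⁻¹ ^ p.2).prod

/-- The length `∑ (m_i + l_i)` of the chain with the given exponents. -/
def chainLength (e : List (ℕ × ℕ)) : ℕ := (e.map fun p => p.1 + p.2).sum

/-- The set of all chains of type (C1) or (C2) of length at most `2‖u‖ + 3`. -/
def Ω (u : F2) : Set (MulAut F2) :=
  {ψ | ∃ e : List (ℕ × ℕ), chainLength e ≤ 2 * cyclicLength u + 3 ∧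
    (ψ = chainC1 e ∨ ψ = chainC2 e)}

end F2

/-!
A cyclically reduced word becomes positive under some automorphism of type (W1) if and only if it
is *coherent*: no generator occurs in it with both exponents. The theorem thus asks how long a
chain must be to make the cyclic word of `u` coherent, if some automorphism does so at all.

*Reduction to chains.* By Nielsen's method (`F2.mem_nielsenGroup`) the automorphism group of `F₂`
is generated by the inner automorphisms, the signed permutations of the generators, and `τ`.
Relations such as `σ⁻¹ τ = π_b ρ σ`, with a signed permutation `ρ`, bring every product of these
generators to the form `π_c β ψ` with a chain `ψ` of type (C1) or (C2) (`F2.isChainLike`). As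
coherence does not see `π_c` and `β`, only chains matter; and since `b ↦ b⁻¹` exchanges the two
types, up to inner automorphisms, only chains of type (C1).

*The cost.* A turn between two different generators is negative if their exponents have opposite
signs. The cost of a cyclic word is the number of letters in those maximal powers of a generator
that are entered through a negative turn; it is at most the length of the word. Written in the
block form `b ^ n₁ a ^ ε₁ ⋯ b ^ n_k a ^ ε_k`, the cyclic word is changed by `σ` only in its
exponents `n_i`, and `F2.blockCost_shift_le` shows that `σ` never raises the cost and keeps it
only if the word is *stuck*. By symmetry the same holds for `τ`.

*Stuck words.* A stuck word falls into one of three classes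
(`F2.IsClosedForm.trichotomy_of_isStuck`). It may contain a subword `x yᵏ x⁻ⁿ y⁻¹`, a persistent
turn, which every chain of type (C1) reproduces, so that no such chain makes the word coherent
(`F2.IsPersistent.not_essPositive`). Otherwise it is coherent already, or all its letters of the
wrong sign are isolated and `τ` cancels them all.

Hence, along a chain that ends in a coherent word, the cost drops at every step until at most one
more letter is needed, and a chain of length at most `‖u‖ + 1` suffices
(`F2.exists_short_chainWord`), which is within the bound `2‖u‖ + 3`. The finite search over these
chains, with a test for coherence, is primitive recursive, and this is the algorithm.
-/

namespace FreeGroup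

/-! ### Cyclically reduced words and conjugacy -/

variable {α : Type*}

theorem isReduced_cons_cons_iff {x y : α × Bool} {L : List (α × Bool)} :
    IsReduced (x :: y :: L) ↔ (x.1 = y.1 → x.2 = y.2) ∧ IsReduced (y :: L) := by
  simp [IsReduced]

/-- A word is cyclically reduced if and only if it stays reduced when its last letter is repeated
in front of it. -/
theorem isCyclicallyReduced_concat_iff {x : α × Bool} {L : List (α × Bool)} :
    IsCyclicallyReduced (L ++ [x]) ↔ IsReduced (x :: (L ++ [x])) := by
  cases L with
  | nil => simp [IsReduced]
  | cons y L =>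
    rw [isCyclicallyReduced_cons_append_iff, List.cons_append, isReduced_cons_cons_iff, and_comm]

theorem IsCyclicallyReduced.rotate_append {L₁ L₂ : List (α × Bool)}
    (h : IsCyclicallyReduced (L₁ ++ L₂)) : IsCyclicallyReduced (L₂ ++ L₁) := by
  rcases List.eq_nil_or_concat L₁ with rfl | ⟨M₁, x, rfl⟩
  · simpa using h
  rcases List.eq_nil_or_concat L₂ with rfl | ⟨M₂, y, rfl⟩
  · simpa using h
  simp only [List.concat_eq_append] at *
  rw [← List.append_assoc, isCyclicallyReduced_concat_iff] at *
  unfold IsReduced at *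
  simp only [List.isChain_cons, List.isChain_append, List.head?_append,
    List.append_assoc] at *
  simp at *
  cases M₁ <;> cases M₂ <;> simp at * <;> tauto

theorem IsCyclicallyReduced.isRotated {L L' : List (α × Bool)}
    (h : IsCyclicallyReduced L) (hr : L ~r L') : IsCyclicallyReduced L' := by
  obtain ⟨n, rfl⟩ := hr
  rw [List.rotate_eq_drop_append_take_mod]
  apply IsCyclicallyReduced.rotate_append
  rwa [List.take_append_drop]

theorem isConj_mk_append (L₁ L₂ : List (α × Bool)) : IsConj (mk (L₁ ++ L₂)) (mk (L₂ ++ L₁)) := by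
  rw [← mul_mk, ← mul_mk, isConj_iff]
  exact ⟨(mk L₁)⁻¹, by group⟩

theorem isConj_mk_of_isRotated {L L' : List (α × Bool)} (h : L ~r L') :
    IsConj (mk L) (mk L') := by
  obtain ⟨n, rfl⟩ := h
  rw [List.rotate_eq_drop_append_take_mod]
  conv_lhs => rw [← List.take_append_drop (n % L.length) L]
  exact isConj_mk_append _ _

variable [DecidableEq α]

theorem IsReduced.toWord_mk {L : List (α × Bool)} (h : IsReduced L) : (mk L).toWord = L := by
  rw [FreeGroup.toWord_mk, h.reduce_eq]

theorem isConj_mk_reduceCyclically (u : FreeGroup α) :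
    IsConj (mk (reduceCyclically u.toWord)) u := by
  rw [isConj_iff]
  refine ⟨mk (reduceCyclically.conjugator u.toWord), ?_⟩
  rw [inv_mk, mul_mk, mul_mk, reduceCyclically.conj_conjugator_reduceCyclically, mk_toWord]

/-- Cyclically reduced words that represent conjugate elements are cyclic permutations of each
other. The induction is on the length of the conjugating word `G`: either its last letter cancels
against an end of `L`, and conjugating by it rotates `L`; or `G L G⁻¹` is reduced, which is
impossible for a cyclically reduced word unless `G` is empty. -/
theorem isRotated_of_mk_eq_conj (n : ℕ) : ∀ {L L' G : List (α × Bool)}, G.length = n →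
    IsReduced G → IsCyclicallyReduced L → IsCyclicallyReduced L' →
    mk L' = mk G * mk L * (mk G)⁻¹ → L ~r L' := by
  induction n with
  | zero =>
    intro L L' G hG _ hL hL' h
    obtain rfl := List.length_eq_zero_iff.mp hG
    have h' : mk L' = mk L := by simpa [← one_eq_mk] using h
    have := congrArg toWord h'
    rw [hL.isReduced.toWord_mk, hL'.isReduced.toWord_mk] at this
    rw [this]
  | succ n ih =>
    intro L L' G hG hGr hL hL' h
    rcases List.eq_nil_or_concat G with rfl | ⟨G, x, rfl⟩
    · simp at hG
    simp only [List.concat_eq_append] at *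
    have hGr' : IsReduced G := hGr.infix ⟨[], [x], by simp⟩
    have hG' : G.length = n := by simpa using hG
    have hx : mk L' = mk G * (mk [x] * mk L * (mk [x])⁻¹) * (mk G)⁻¹ := by
      rw [h, ← mul_mk]; group
    by_cases h1 : ∃ M, L = (x.1, !x.2) :: M
    · obtain ⟨M, rfl⟩ := h1
      have e : mk [x] * mk ((x.1, !x.2) :: M) * (mk [x])⁻¹ = mk (M ++ [(x.1, !x.2)]) := by
        have ex : mk [(x.1, !x.2)] = (mk [x])⁻¹ := by simp [inv_mk, invRev]
        have el : mk ((x.1, !x.2) :: M) = (mk [x])⁻¹ * mk M := by rw [← ex, mul_mk]; rfl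
        rw [el, ← mul_mk, ex]
        group
      rw [e] at hx
      exact (List.IsRotated.symm ⟨M.length, by simp⟩).trans
        (ih hG' hGr' (IsCyclicallyReduced.rotate_append (L₁ := [(x.1, !x.2)]) hL) hL' hx)
    by_cases h2 : ∃ M, L = M ++ [x]
    · obtain ⟨M, rfl⟩ := h2
      have e : mk [x] * mk (M ++ [x]) * (mk [x])⁻¹ = mk ([x] ++ M) := by
        rw [← mul_mk, ← mul_mk]; group
      rw [e] at hx
      exact (show M ++ [x] ~r [x] ++ M from ⟨M.length, by simp⟩).trans
        (ih hG' hGr' (IsCyclicallyReduced.rotate_append hL) hL' hx)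
    by_cases hLn : L = []
    · subst hLn
      have h' : mk L' = 1 := by rw [h, ← one_eq_mk]; group
      have := congrArg toWord h'
      rw [hL'.isReduced.toWord_mk, toWord_one] at this
      rw [this]
    exfalso
    have hred : IsReduced (G ++ [x] ++ L ++ invRev (G ++ [x])) := by
      have hinv : IsReduced (invRev (G ++ [x])) := by
        have := isReduced_toWord (x := (mk (G ++ [x]))⁻¹)
        rwa [toWord_inv, hGr.toWord_mk] at this
      have hL1 := hL.isReduced
      unfold IsReduced at *
      obtain ⟨y, M, rfl⟩ := List.exists_cons_of_ne_nil hLn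
      refine (hGr.append hL1 ?_).append hinv ?_
      · simp only [List.getLast?_concat, List.head?_cons, Option.mem_def, Option.some.injEq]
        rintro _ rfl _ rfl h
        by_contra h'
        exact h1 ⟨M, by rw [List.cons.injEq]; exact ⟨Prod.ext h.symm (by simp; grind), rfl⟩⟩
      · rcases List.eq_nil_or_concat (y :: M) with h0 | ⟨N, z, hz⟩
        · simp at h0
        rw [hz] at h2 ⊢
        simp only [List.concat_eq_append, invRev, List.map_append, List.map_cons, List.map_nil,
          List.reverse_append, List.reverse_cons, List.reverse_nil, List.nil_append,
          List.singleton_append, List.head?_cons, ← List.append_assoc, List.getLast?_concat,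
          Option.mem_def, Option.some.injEq]
        rintro _ rfl _ rfl h
        by_contra h'
        exact h2 ⟨N, by rw [show z = x from Prod.ext h (by simp at h'; grind)]; simp⟩
    have he : L' = G ++ [x] ++ L ++ invRev (G ++ [x]) := by
      rw [inv_mk, mul_mk, mul_mk] at h
      have := congrArg toWord h
      rwa [hL'.isReduced.toWord_mk, hred.toWord_mk] at this
    obtain ⟨g, T, hgT⟩ := List.exists_cons_of_ne_nil (l := G ++ [x]) (by simp)
    have hcr := hL'.2
    rw [he, hgT, show g :: T ++ L ++ invRev (g :: T) = (g :: (T ++ L ++ invRev T)) ++ [(g.1, !g.2)]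
      by simp [invRev]] at hcr
    simpa using hcr (g.1, !g.2) (by rw [List.getLast?_concat]; rfl) g (by simp)

theorem IsCyclicallyReduced.isRotated_of_isConj {L L' : List (α × Bool)}
    (hL : IsCyclicallyReduced L) (hL' : IsCyclicallyReduced L') (h : IsConj (mk L) (mk L')) :
    L ~r L' := by
  obtain ⟨c, hc⟩ := isConj_iff.mp h
  refine isRotated_of_mk_eq_conj _ (G := c.toWord) rfl isReduced_toWord hL hL' ?_
  rw [mk_toWord, hc]

end FreeGroup

namespace F2

open FreeGroup hiding map_one map_mul map_inv

/-! ### Positive cyclic words -/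

theorem cyclicWord_eq_of_isConj {u v : F2} (h : IsConj u v) : cyclicWord u = cyclicWord v :=
  Cycle.coe_eq_coe.mpr <|
    (reduceCyclically.isCyclicallyReduced isReduced_toWord).isRotated_of_isConj
    (reduceCyclically.isCyclicallyReduced isReduced_toWord)
    (((isConj_mk_reduceCyclically u).trans h).trans (isConj_mk_reduceCyclically v).symm)

theorem cyclicWord_eq_of_isCyclicallyReduced {u : F2} {L : List (Fin 2 × Bool)}
    (hL : IsCyclicallyReduced L) (h : IsConj (mk L) u) : cyclicWord u = (L : CyclicWord) :=
  Cycle.coe_eq_coe.mpr <|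
    (reduceCyclically.isCyclicallyReduced isReduced_toWord).isRotated_of_isConj
    hL ((isConj_mk_reduceCyclically u).trans h.symm)

/-- A word is coherent if no generator occurs in it with both exponents. -/
def Coherent (L : List (Fin 2 × Bool)) : Prop := ∀ x ∈ L, ∀ y ∈ L, x.1 = y.1 → x.2 = y.2

theorem Coherent.isCyclicallyReduced {L : List (Fin 2 × Bool)} (h : Coherent L) :
    IsCyclicallyReduced L :=
  ⟨(List.pairwise_iff_forall_sublist.mpr fun hs =>
      h _ (hs.subset (by simp)) _ (hs.subset (by simp))).isChain,
    fun _ hx _ hy => h _ (List.mem_of_getLast? hx) _ (List.mem_of_head? hy)⟩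

theorem isCyclicallyReduced_of_isPositive {L : List (Fin 2 × Bool)}
    (h : ∀ x ∈ L, x.2 = true) : IsCyclicallyReduced L := by
  have h2 : ∀ x ∈ L, ∀ y ∈ L, x.1 = y.1 → x.2 = y.2 := fun x hx y hy _ => by rw [h x hx, h y hy]
  exact Coherent.isCyclicallyReduced h2

theorem cyclicWord_isPositive_iff (u : F2) :
    (cyclicWord u).IsPositive ↔ ∃ c : F2, IsPositive (MulAut.conj c u) := by
  constructor
  · intro h
    obtain ⟨c, hc⟩ := isConj_iff.mp (isConj_mk_reduceCyclically u).symm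
    refine ⟨c, fun x hx => h x ?_⟩
    rw [MulAut.conj_apply, hc,
      (reduceCyclically.isCyclicallyReduced isReduced_toWord).isReduced.toWord_mk] at hx
    exact hx
  · rintro ⟨c, hc⟩
    rw [cyclicWord_eq_of_isCyclicallyReduced (L := (MulAut.conj c u).toWord)
      (isCyclicallyReduced_of_isPositive hc)]
    · exact fun x hx => hc x hx
    · rw [mk_toWord]
      exact (isConj_iff.mpr ⟨c, rfl⟩ : IsConj u (MulAut.conj c u)).symm

/-! ### Automorphisms of type (W1) -/

theorem mem_letters_iff {v : F2} : v ∈ letters ↔ ∃ x : Fin 2 × Bool, v = mk [x] := by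
  constructor
  · rintro (rfl | rfl | rfl | rfl)
    · exact ⟨(0, true), rfl⟩
    · exact ⟨(1, true), rfl⟩
    · exact ⟨(0, false), rfl⟩
    · exact ⟨(1, false), rfl⟩
  · rintro ⟨⟨i, e⟩, rfl⟩
    fin_cases i <;> cases e
    · exact .inr (.inr (.inl rfl))
    · exact .inl rfl
    · exact .inr (.inr (.inr rfl))
    · exact .inr (.inl rfl)

theorem mk_flip (x : Fin 2 × Bool) : (mk [(x.1, !x.2)] : F2) = (mk [x])⁻¹ := by
  simp [inv_mk, invRev]

theorem mk_singleton_injective : Function.Injective (fun x : Fin 2 × Bool => (mk [x] : F2)) := by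
  intro x y h
  have := congrArg toWord h
  simpa using this

theorem isW1_iff {β : MulAut F2} : IsW1 β ↔ ∀ i, β (of i) ∈ letters := by
  constructor
  · intro h i
    exact h.mapsTo (mem_letters_iff.mpr ⟨(i, true), rfl⟩)
  · intro h
    have hfin : letters.Finite := by simp [letters]
    have hmaps : Set.MapsTo β letters letters := by
      intro v hv
      obtain ⟨⟨i, e⟩, rfl⟩ := mem_letters_iff.mp hv
      obtain ⟨y, hy⟩ := mem_letters_iff.mp (h i)
      cases e
      · refine mem_letters_iff.mpr ⟨(y.1, !y.2), ?_⟩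
        rw [mk_flip, ← hy, ← map_inv]; rfl
      · exact h i
    exact (hfin.injOn_iff_bijOn_of_mapsTo hmaps).mp β.injective.injOn

theorem IsW1.mul {β γ : MulAut F2} (hβ : IsW1 β) (hγ : IsW1 γ) : IsW1 (β * γ) :=
  Set.BijOn.comp (g := β) hβ hγ

theorem IsW1.one : IsW1 1 := Set.bijOn_id _

theorem finite_isW1 : {β : MulAut F2 | IsW1 β}.Finite := by
  have hfin : letters.Finite := by simp [letters]
  have : {f : Fin 2 → F2 | ∀ i, f i ∈ letters}.Finite := Set.Finite.pi' fun _ => hfin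
  refine Set.Finite.of_finite_image (f := fun β : MulAut F2 => fun i => β (of i))
    (this.subset ?_) ?_
  · rintro _ ⟨β, hβ, rfl⟩ i
    exact isW1_iff.mp hβ i
  · intro β _ γ _ h
    refine MulEquiv.toMonoidHom_injective (FreeGroup.ext_hom _ _ fun i => congrFun h i)

/-- A type (W1) automorphism acts on words letter by letter, by a map that commutes with the
inversion of letters. -/
theorem IsW1.exists_letter_map {β : MulAut F2} (hβ : IsW1 β) :
    ∃ g : Fin 2 × Bool → Fin 2 × Bool, Function.Injective g ∧
      (∀ x, g (x.1, !x.2) = ((g x).1, !(g x).2)) ∧ ∀ L, β (mk L) = mk (L.map g) := by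
  have h : ∀ x : Fin 2 × Bool, ∃ y, β (mk [x]) = mk [y] := fun x =>
    mem_letters_iff.mp (hβ.mapsTo (mem_letters_iff.mpr ⟨x, rfl⟩))
  choose g hg using h
  refine ⟨g, fun x y hxy => ?_, fun x => ?_, fun L => ?_⟩
  · apply mk_singleton_injective
    apply β.injective
    simp only [hg, hxy]
  · apply mk_singleton_injective
    simp only [← hg, mk_flip, map_inv]
  · induction L with
    | nil => exact map_one β
    | cons x L ih =>
      rw [← List.singleton_append, ← mul_mk, map_mul, hg, ih, mul_mk]; rfl

theorem isCyclicallyReduced_map {g : Fin 2 × Bool → Fin 2 × Bool} (hinj : Function.Injective g)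
    (hg : ∀ x, g (x.1, !x.2) = ((g x).1, !(g x).2)) {L : List (Fin 2 × Bool)}
    (hL : IsCyclicallyReduced L) : IsCyclicallyReduced (L.map g) := by
  have key : ∀ x y : Fin 2 × Bool, (x.1 = y.1 → x.2 = y.2) → (g x).1 = (g y).1 →
      (g x).2 = (g y).2 := by
    intro x y hxy h
    by_contra h2
    have : g x = g (y.1, !y.2) := by
      rw [hg]; exact Prod.ext h (by simp; grind)
    have := hinj this
    subst this
    simp at hxy
  refine ⟨List.isChain_map_of_isChain g (fun x y => key x y) hL.1, ?_⟩
  intro x hx y hy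
  rw [List.getLast?_map] at hx
  rw [List.head?_map] at hy
  obtain ⟨x', hx', rfl⟩ := Option.mem_map.mp hx
  obtain ⟨y', hy', rfl⟩ := Option.mem_map.mp hy
  exact key x' y' (hL.2 x' hx' y' hy')

/-- The automorphism that maps the generator `of i` to `of i` or to `(of i)⁻¹`, according to the
sign `s i`. -/
def signAut (s : Fin 2 → Bool) : MulAut F2 :=
  MonoidHom.toMulEquiv
    (FreeGroup.lift fun i => mk [(i, s i)])
    (FreeGroup.lift fun i => mk [(i, s i)])
    (by ext i; cases h : s i <;> simp [h, invRev, ← FreeGroup.of.eq_1])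
    (by ext i; cases h : s i <;> simp [h, invRev, ← FreeGroup.of.eq_1])

theorem signAut_of (s : Fin 2 → Bool) (i : Fin 2) : signAut s (of i) = mk [(i, s i)] := by
  simp [signAut]

theorem isW1_signAut (s : Fin 2 → Bool) : IsW1 (signAut s) :=
  isW1_iff.mpr fun i => mem_letters_iff.mpr ⟨_, signAut_of s i⟩

theorem signAut_mk (s : Fin 2 → Bool) (L : List (Fin 2 × Bool)) :
    signAut s (mk L) = mk (L.map fun x => (x.1, x.2 == s x.1)) := by
  induction L with
  | nil => exact map_one _
  | cons x L ih =>
    rw [← List.singleton_append, ← mul_mk, map_mul, ih, List.map_append, ← mul_mk]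
    congr 1
    obtain ⟨i, e⟩ := x
    cases e
    · rw [show (mk [(i, false)] : F2) = (of i)⁻¹ from rfl, map_inv, signAut_of, ← mk_flip]
      cases h : s i <;> simp [h]
    · rw [show (mk [(i, true)] : F2) = of i from rfl, signAut_of]
      cases h : s i <;> simp [h]

/-! ### Essential positivity -/

/-- The cyclic word of `v` becomes positive under some automorphism of type (W1). For a cyclically
reduced word this says that no generator occurs with both exponents, see `essPositive_mk_iff`. -/
def EssPositive (v : F2) : Prop := ∃ β : MulAut F2, IsW1 β ∧ (cyclicWord (β v)).IsPositive

theorem EssPositive.of_isConj {u v : F2} (hu : EssPositive u) (h : IsConj u v) :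
    EssPositive v := by
  obtain ⟨β, hβ, hp⟩ := hu
  refine ⟨β, hβ, ?_⟩
  rwa [← cyclicWord_eq_of_isConj (u := β u)]
  exact β.toMonoidHom.map_isConj h

theorem EssPositive.of_isW1 {β : MulAut F2} (hβ : IsW1 β) {v : F2} (h : EssPositive (β v)) :
    EssPositive v := by
  obtain ⟨γ, hγ, hp⟩ := h
  exact ⟨γ * β, hγ.mul hβ, hp⟩

theorem essPositive_of_coherent {L : List (Fin 2 × Bool)} (h : Coherent L) :
    EssPositive (mk L) := by
  classical
  refine ⟨signAut fun i => decide ((i, true) ∈ L), isW1_signAut _, ?_⟩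
  have hp : ∀ x ∈ L.map fun x => (x.1, x.2 == decide ((x.1, true) ∈ L)), x.2 = true := by
    intro x hx
    obtain ⟨⟨i, e⟩, hy, rfl⟩ := List.mem_map.mp hx
    cases e
    · simp only [beq_iff_eq]
      symm
      rw [decide_eq_false_iff_not]
      intro h'
      simpa using h _ hy _ h' rfl
    · simpa using hy
  rw [signAut_mk, cyclicWord_eq_of_isCyclicallyReduced (isCyclicallyReduced_of_isPositive hp)
    (IsConj.refl _)]
  exact fun x hx => hp x hx

theorem essPositive_mk_iff {L : List (Fin 2 × Bool)} (hL : IsCyclicallyReduced L) :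
    EssPositive (mk L) ↔ Coherent L := by
  refine ⟨?_, essPositive_of_coherent⟩
  rintro ⟨β, hβ, hp⟩ x hx y hy hxy
  obtain ⟨g, hinj, hg, hβg⟩ := hβ.exists_letter_map
  rw [hβg, cyclicWord_eq_of_isCyclicallyReduced (isCyclicallyReduced_map hinj hg hL)
    (IsConj.refl _)] at hp
  have hpos : ∀ z ∈ L, (g z).2 = true := fun z hz => hp (g z) (List.mem_map_of_mem hz)
  by_contra h2
  have : x = (y.1, !y.2) := Prod.ext hxy (by simp; grind)
  have h3 := hpos x hx
  rw [this, hg, hpos y hy] at h3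
  simp at h3

end F2

namespace FreeGroup

/-! ### Common prefixes and cancellation -/

variable {α : Type*} [DecidableEq α]

/-- The length of the longest common prefix of two words. -/
def lcpLength : List (α × Bool) → List (α × Bool) → ℕ
  | x :: s, y :: t => if x = y then lcpLength s t + 1 else 0
  | _, _ => 0

theorem lcpLength_comm : ∀ s t : List (α × Bool), lcpLength s t = lcpLength t s
  | [], [] => rfl
  | [], _ :: _ => rfl
  | _ :: _, [] => rfl
  | x :: s, y :: t => by
    simp only [lcpLength, lcpLength_comm s t, eq_comm]

/-- The tree inequality for common prefixes. -/
theorem min_lcpLength_le : ∀ s t u : List (α × Bool),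
    min (lcpLength s t) (lcpLength t u) ≤ lcpLength s u
  | [], t, u => by simp [lcpLength]
  | x :: s, [], u => by simp [lcpLength]
  | x :: s, y :: t, [] => by simp [lcpLength]
  | x :: s, y :: t, z :: u => by
    have := min_lcpLength_le s t u
    simp only [lcpLength]
    split_ifs <;> first | omega | simp_all

/-- In the product of `(mk s)⁻¹` and `mk t` exactly the common prefix of `s` and `t` cancels. -/
theorem length_inv_mul_add_lcpLength : ∀ {s t : List (α × Bool)}, IsReduced s → IsReduced t →
    norm ((mk s)⁻¹ * mk t) + 2 * lcpLength s t = s.length + t.length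
  | [], t, _, ht => by simp [lcpLength, norm, ← one_eq_mk, ht.reduce_eq]
  | x :: s, [], hs, _ => by
    rw [← one_eq_mk, mul_one, norm_inv_eq, norm, hs.toWord_mk]; simp [lcpLength]
  | x :: s, y :: t, hs, ht => by
    by_cases h : x = y
    · subst h
      have ih := length_inv_mul_add_lcpLength (s := s) (t := t) (hs.infix ⟨[x], [], by simp⟩)
        (ht.infix ⟨[x], [], by simp⟩)
      have e : (mk (x :: s))⁻¹ * mk (x :: t) = (mk s)⁻¹ * mk t := by
        rw [← List.singleton_append, ← mul_mk, ← List.singleton_append (l := t), ← mul_mk]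
        group
      rw [e]
      simp only [lcpLength, if_true, List.length_cons]
      omega
    · have hinv : IsReduced (invRev (x :: s)) := by
        have := isReduced_toWord (x := (mk (x :: s))⁻¹)
        rwa [toWord_inv, hs.toWord_mk] at this
      have hred : IsReduced (invRev (x :: s) ++ y :: t) := by
        refine hinv.append ht ?_
        simp only [invRev, List.map_cons, List.reverse_cons, List.getLast?_concat, List.head?_cons,
          Option.mem_def, Option.some.injEq]
        rintro _ rfl _ rfl h1
        by_contra h2
        exact h (Prod.ext h1 (by simp at h2; grind))
      rw [inv_mk, mul_mk, norm, hred.toWord_mk]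
      simp [lcpLength, h]

/-- The Gromov product of `u` and `v` based at `1` in the Cayley tree: the length of the longest
common prefix of the two reduced words. -/
def gromov (u v : FreeGroup α) : ℕ := lcpLength u.toWord v.toWord

theorem gromov_comm (u v : FreeGroup α) : gromov u v = gromov v u := lcpLength_comm _ _

theorem min_gromov_le (u v w : FreeGroup α) : min (gromov u v) (gromov v w) ≤ gromov u w :=
  min_lcpLength_le _ _ _

theorem norm_inv_mul_add_gromov (u v : FreeGroup α) :
    norm (u⁻¹ * v) + 2 * gromov u v = norm u + norm v := by
  have := length_inv_mul_add_lcpLength (isReduced_toWord (x := u)) (isReduced_toWord (x := v))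
  rwa [mk_toWord, mk_toWord] at this

theorem norm_mul_add_gromov (u v : FreeGroup α) :
    norm (u * v) + 2 * gromov u⁻¹ v = norm u + norm v := by
  simpa using norm_inv_mul_add_gromov u⁻¹ v

/-- The prefix of length `h` of the reduced word of `u`. -/
theorem exists_prefix (u : FreeGroup α) {h : ℕ} (hh : h ≤ norm u) :
    ∃ q : FreeGroup α, norm q = h ∧ norm (q⁻¹ * u) + h = norm u := by
  have hu := isReduced_toWord (x := u)
  refine ⟨mk (u.toWord.take h), ?_, ?_⟩
  · rw [norm, IsReduced.toWord_mk (hu.infix (List.take_prefix _ _).isInfix)]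
    exact List.length_take_of_le hh
  · have : (mk (u.toWord.take h))⁻¹ * u = mk (u.toWord.drop h) := by
      have e : u = mk (u.toWord.take h) * mk (u.toWord.drop h) := by
        rw [mul_mk, List.take_append_drop, mk_toWord]
      rw [inv_mul_eq_iff_eq_mul, ← e]
    rw [this, norm, IsReduced.toWord_mk (hu.infix (List.drop_suffix _ _).isInfix)]
    simp only [norm] at *
    simp; omega

/-- Less than half of a reduced word cancels in its square. -/
theorem norm_lt_norm_mul_self {x : FreeGroup α} (hx : x ≠ 1) : norm x < norm (x * x) := by
  have h := reduceCyclically.conj_conjugator_reduceCyclically x.toWord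
  have h2 := toWord_pow x 2
  rw [reduceCyclically.reduce_flatten_replicate isReduced_toWord, if_neg two_ne_zero] at h2
  have hpos : 0 < (reduceCyclically x.toWord).length := by
    rw [List.length_pos_iff]
    intro h0
    rw [h0] at h
    have := congrArg mk h
    rw [mk_toWord, List.append_nil, ← mul_mk, ← inv_mk, mul_inv_cancel] at this
    exact hx this.symm
  rw [← pow_two, norm, norm, h2]
  conv_lhs => rw [← h]
  simp [List.replicate]
  omega

end FreeGroup

namespace F2

open FreeGroup hiding map_one map_mul map_inv

/-! ### Nielsen minimal pairs -/

/-- The four elements `x, x⁻¹, y, y⁻¹` for the pair `x = φ a`, `y = φ b`. -/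
def basisLetter (φ : MulAut F2) (l : Fin 2 × Bool) : F2 := φ (mk [l])

theorem basisLetter_flip (φ : MulAut F2) (l : Fin 2 × Bool) :
    basisLetter φ (l.1, !l.2) = (basisLetter φ l)⁻¹ := by
  simp only [basisLetter, mk_flip]
  exact _root_.map_inv φ _

theorem basisLetter_ne_one (φ : MulAut F2) (l : Fin 2 × Bool) : basisLetter φ l ≠ 1 := by
  intro h
  have : (mk [l] : F2) = 1 := φ.injective (h.trans (_root_.map_one φ).symm)
  have := congrArg toWord this
  simp at this

/-- The pair `φ a, φ b` is not shortened by a simultaneous conjugation that follows an elementary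
Nielsen transformation. -/
def IsNielsenMinimal (φ : MulAut F2) : Prop :=
  ∀ l m : Fin 2 × Bool, l.1 ≠ m.1 → ∀ q : F2,
    norm (basisLetter φ l) + norm (basisLetter φ m) ≤
      norm (q⁻¹ * basisLetter φ l * q) +
        norm (q⁻¹ * (basisLetter φ m * basisLetter φ l) * q)

theorem IsNielsenMinimal.norm_le {φ : MulAut F2} (h : IsNielsenMinimal φ) {l m : Fin 2 × Bool}
    (hlm : l.1 ≠ m.1) : norm (basisLetter φ m) ≤ norm (basisLetter φ m * basisLetter φ l) := by
  simpa using h l m hlm 1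

theorem IsNielsenMinimal.norm_le' {φ : MulAut F2} (h : IsNielsenMinimal φ) {l m : Fin 2 × Bool}
    (hlm : l.1 ≠ m.1) : norm (basisLetter φ m) ≤ norm (basisLetter φ l * basisLetter φ m) := by
  have := h.norm_le (l := (l.1, !l.2)) (m := (m.1, !m.2)) hlm
  rwa [basisLetter_flip, basisLetter_flip, ← mul_inv_rev, norm_inv_eq, norm_inv_eq] at this

/-- If half of `x = φ l` cancels in both products of `φ m * x * φ m`, then conjugating by the
second half of `x` makes the pair `x, φ m * x` shorter than `x, φ m`. -/
theorem IsNielsenMinimal.not_half_half {φ : MulAut F2} (h : IsNielsenMinimal φ)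
    {l m : Fin 2 × Bool} (hlm : l.1 ≠ m.1)
    (h1 : 2 * gromov (basisLetter φ m)⁻¹ (basisLetter φ l) = norm (basisLetter φ l))
    (h2 : 2 * gromov (basisLetter φ l)⁻¹ (basisLetter φ m) = norm (basisLetter φ l)) : False := by
  have hmin := h l m hlm
  have hle := h.norm_le' (l := m) (m := l) hlm.symm
  have hx1 := basisLetter_ne_one φ l
  generalize basisLetter φ l = x at *
  generalize basisLetter φ m = y at *
  have hpos : 0 < norm x := Nat.pos_of_ne_zero (by simpa using hx1)
  obtain ⟨q, hq, hq'⟩ := exists_prefix x⁻¹ (h := gromov x⁻¹ y) (by rw [norm_inv_eq]; omega)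
  specialize hmin q
  rw [norm_inv_eq] at hq'
  -- `p` is the other half of `x = p * q⁻¹`
  set p := x * q with hp
  have hpn : norm p = gromov x⁻¹ y := by
    have : norm p = norm (q⁻¹ * x⁻¹) := by rw [← norm_inv_eq, hp, mul_inv_rev]
    omega
  have e1 : q⁻¹ * x * q = q⁻¹ * p := by rw [hp]; group
  have e2 : q⁻¹ * (y * x) * q = q⁻¹ * (y * p) := by rw [hp]; group
  rw [e1, e2] at hmin
  have hb := norm_mul_le q⁻¹ p
  rw [norm_inv_eq] at hb
  -- Gromov products along the words of `x` and `y`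
  have g1 := norm_inv_mul_add_gromov q x⁻¹
  have g2 := norm_inv_mul_add_gromov q y
  have g3 := min_gromov_le q x⁻¹ y
  have g4 := norm_inv_mul_add_gromov p x
  have e3 : p⁻¹ * x = q⁻¹ := by rw [hp]; group
  rw [e3, norm_inv_eq] at g4
  have g5 := min_gromov_le y⁻¹ x p
  have g6 := norm_mul_add_gromov y p
  have g7 := norm_inv_mul_add_gromov y (y * p)
  have e4 : y⁻¹ * (y * p) = p := by group
  rw [e4] at g7
  have g8 := min_gromov_le q y (y * p)
  have g9 := norm_inv_mul_add_gromov q (y * p)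
  have g10 := norm_mul_add_gromov y x
  rw [gromov_comm x p] at g5
  rw [norm_inv_eq] at g1
  have t1 := norm_mul_le q (q⁻¹ * y)
  rw [mul_inv_cancel_left] at t1
  omega

/-- In a Nielsen minimal pair the cancellations on both sides of a factor do not exhaust it. -/
theorem IsNielsenMinimal.gromov_add_gromov_lt {φ : MulAut F2} (h : IsNielsenMinimal φ)
    {k l m : Fin 2 × Bool} (hkl : k.1 = l.1 → k.2 = l.2) (hlm : l.1 = m.1 → l.2 = m.2) :
    gromov (basisLetter φ k)⁻¹ (basisLetter φ l) + gromov (basisLetter φ l)⁻¹ (basisLetter φ m) <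
      norm (basisLetter φ l) := by
  have hsq : 2 * gromov (basisLetter φ l)⁻¹ (basisLetter φ l) < norm (basisLetter φ l) := by
    have h1 := norm_lt_norm_mul_self (basisLetter_ne_one φ l)
    have h2 := norm_mul_add_gromov (basisLetter φ l) (basisLetter φ l)
    omega
  have hleft : ∀ k : Fin 2 × Bool, k.1 ≠ l.1 →
      2 * gromov (basisLetter φ k)⁻¹ (basisLetter φ l) ≤ norm (basisLetter φ l) := by
    intro k hk
    have h1 := h.norm_le hk.symm
    have h2 := norm_mul_add_gromov (basisLetter φ k) (basisLetter φ l)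
    omega
  have hright : ∀ m : Fin 2 × Bool, l.1 ≠ m.1 →
      2 * gromov (basisLetter φ l)⁻¹ (basisLetter φ m) ≤ norm (basisLetter φ l) := by
    intro m hm
    have h1 := h.norm_le' hm
    have h2 := norm_mul_add_gromov (basisLetter φ l) (basisLetter φ m)
    omega
  by_cases hk : k.1 = l.1
  · obtain rfl : k = l := Prod.ext hk (hkl hk)
    by_cases hm : k.1 = m.1
    · obtain rfl : k = m := Prod.ext hm (hlm hm)
      omega
    · have := hright m hm
      omega
  · have hk' := hleft k hk
    by_cases hm : l.1 = m.1
    · obtain rfl : l = m := Prod.ext hm (hlm hm)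
      omega
    · have hm' := hright m hm
      by_contra hcon
      have e1 : 2 * gromov (basisLetter φ k)⁻¹ (basisLetter φ l) = norm (basisLetter φ l) := by
        omega
      have e2 : 2 * gromov (basisLetter φ l)⁻¹ (basisLetter φ m) = norm (basisLetter φ l) := by
        omega
      have hkm : k.1 = m.1 := by omega
      by_cases hkm2 : k.2 = m.2
      · obtain rfl : k = m := Prod.ext hkm hkm2
        exact h.not_half_half hm e1 e2
      · obtain rfl : k = (m.1, !m.2) := Prod.ext hkm (by simp; grind)
        rw [basisLetter_flip, inv_inv] at e1
        have := min_gromov_le (basisLetter φ l)⁻¹ (basisLetter φ m) (basisLetter φ l)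
        omega

theorem map_mk_cons (φ : MulAut F2) (l : Fin 2 × Bool) (L : List (Fin 2 × Bool)) :
    φ (mk (l :: L)) = basisLetter φ l * φ (mk L) := by
  rw [← List.singleton_append, ← mul_mk]
  exact _root_.map_mul φ _ _

/-- Every syllable of a reduced word in a Nielsen minimal pair leaves a letter. The second
statement says that the cancellation between the first syllable and the rest of the word does not
reach beyond the second syllable. -/
theorem IsNielsenMinimal.length_le {φ : MulAut F2} (h : IsNielsenMinimal φ) :
    ∀ (l : Fin 2 × Bool) (L : List (Fin 2 × Bool)), IsReduced (l :: L) →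
    ∀ k : Fin 2 × Bool, (k.1 = l.1 → k.2 = l.2) →
      gromov (basisLetter φ k)⁻¹ (φ (mk (l :: L))) = gromov (basisLetter φ k)⁻¹ (basisLetter φ l) ∧
      L.length + 1 + gromov (basisLetter φ k)⁻¹ (basisLetter φ l) ≤ norm (φ (mk (l :: L)))
  | l, [], _, k, hk => by
    have h1 := h.gromov_add_gromov_lt (m := l) hk fun _ => rfl
    have e : φ (mk [l]) = basisLetter φ l := rfl
    rw [e]
    refine ⟨rfl, ?_⟩
    simp only [List.length_nil]
    omega
  | l, m :: L, hL, k, hk => by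
    rw [isReduced_cons_cons_iff] at hL
    obtain ⟨ih1, ih2⟩ := IsNielsenMinimal.length_le h m L hL.2 l hL.1
    have h1 := h.gromov_add_gromov_lt hk hL.1
    rw [map_mk_cons]
    have g1 := norm_mul_add_gromov (basisLetter φ l) (φ (mk (m :: L)))
    have g2 := norm_inv_mul_add_gromov (basisLetter φ l) (basisLetter φ l * φ (mk (m :: L)))
    rw [inv_mul_cancel_left] at g2
    have g3 := min_gromov_le (basisLetter φ k)⁻¹ (basisLetter φ l)
      (basisLetter φ l * φ (mk (m :: L)))
    have g4 := min_gromov_le (basisLetter φ k)⁻¹ (basisLetter φ l * φ (mk (m :: L)))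
      (basisLetter φ l)
    rw [gromov_comm _ (basisLetter φ l)] at g4
    have hc : gromov (basisLetter φ k)⁻¹ (basisLetter φ l * φ (mk (m :: L))) =
        gromov (basisLetter φ k)⁻¹ (basisLetter φ l) := by omega
    refine ⟨hc, ?_⟩
    simp only [List.length_cons]
    omega

/-- The inverse of a Nielsen minimal automorphism is of type (W1): a generator has length one, so
it is a word of a single syllable in `φ a`, `φ b`. -/
theorem IsNielsenMinimal.isW1_inv {φ : MulAut F2} (h : IsNielsenMinimal φ) : IsW1 φ⁻¹ := by
  rw [isW1_iff]
  intro i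
  have hone : norm (φ (φ⁻¹ (of i))) = 1 := by
    rw [MulAut.apply_inv_self]; exact norm_of i
  rw [← mk_toWord (x := φ⁻¹ (of i))] at hone ⊢
  have hred := isReduced_toWord (x := φ⁻¹ (of i))
  cases hw : (φ⁻¹ (of i)).toWord with
  | nil => rw [hw, ← one_eq_mk, _root_.map_one φ] at hone; simp at hone
  | cons l L =>
    rw [hw] at hone hred
    have := (h.length_le l L hred l fun _ => rfl).2
    obtain rfl : L = [] := List.length_eq_zero_iff.mp (by omega)
    exact mem_letters_iff.mpr ⟨l, rfl⟩

/-! ### Signed permutations and Nielsen's theorem -/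

theorem aut_ext {φ ψ : MulAut F2} (h0 : φ a = ψ a) (h1 : φ b = ψ b) : φ = ψ := by
  refine MulEquiv.toMonoidHom_injective (FreeGroup.ext_hom _ _ fun i => ?_)
  fin_cases i
  · exact h0
  · exact h1

theorem mk_zero_true : (mk [(0, true)] : F2) = a := rfl
theorem mk_one_true : (mk [(1, true)] : F2) = b := rfl
theorem mk_zero_false : (mk [(0, false)] : F2) = a⁻¹ := rfl
theorem mk_one_false : (mk [(1, false)] : F2) = b⁻¹ := rfl

theorem σ_a : σ a = a * b := by simp [σ, a]
theorem σ_b : σ b = b := by simp [σ, b]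
theorem τ_a : τ a = a := by simp [τ, a]
theorem τ_b : τ b = b * a := by simp [τ, b]
theorem σ_symm_a : σ.symm a = a * b⁻¹ := by
  rw [MulEquiv.symm_apply_eq, map_mul, map_inv, σ_a, σ_b]; group
theorem σ_symm_b : σ.symm b = b := by rw [MulEquiv.symm_apply_eq, σ_b]
theorem τ_symm_a : τ.symm a = a := by rw [MulEquiv.symm_apply_eq, τ_a]
theorem τ_symm_b : τ.symm b = b * a⁻¹ := by
  rw [MulEquiv.symm_apply_eq, map_mul, map_inv, τ_a, τ_b]; group

/-- The automorphism that exchanges `a` and `b`. -/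
def swapAut : MulAut F2 := freeGroupCongr (Equiv.swap 0 1)

theorem swapAut_a : swapAut a = b := by simp [swapAut, a, b]
theorem swapAut_b : swapAut b = a := by simp [swapAut, a, b]

theorem signAut_a (s : Fin 2 → Bool) : signAut s a = mk [(0, s 0)] := signAut_of s 0
theorem signAut_b (s : Fin 2 → Bool) : signAut s b = mk [(1, s 1)] := signAut_of s 1

/-- The group of signed permutations of the generators. -/
def signedPerms : Subgroup (MulAut F2) := Subgroup.closure (insert swapAut (Set.range signAut))

theorem swapAut_mem : swapAut ∈ signedPerms := Subgroup.subset_closure (by simp)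

theorem signAut_mem (s : Fin 2 → Bool) : signAut s ∈ signedPerms :=
  Subgroup.subset_closure (by simp)

theorem swapAut_mul_self : swapAut * swapAut = 1 :=
  aut_ext (by simp [swapAut_a, swapAut_b]) (by simp [swapAut_a, swapAut_b])

theorem signAut_mul_self (s : Fin 2 → Bool) : signAut s * signAut s = 1 :=
  (signAut s).self_trans_symm

theorem isW1_of_mem_signedPerms {β : MulAut F2} (h : β ∈ signedPerms) : IsW1 β := by
  have hs : IsW1 swapAut := isW1_iff.mpr fun i => by
    fin_cases i
    · exact mem_letters_iff.mpr ⟨(1, true), swapAut_a⟩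
    · exact mem_letters_iff.mpr ⟨(0, true), swapAut_b⟩
  induction h using Subgroup.closure_induction_left with
  | one => exact IsW1.one
  | mul_left x hx y _ ih =>
    rcases hx with rfl | ⟨s, rfl⟩
    · exact hs.mul ih
    · exact (isW1_signAut s).mul ih
  | inv_mul_cancel x hx y _ ih =>
    rcases hx with rfl | ⟨s, rfl⟩
    · rw [inv_eq_of_mul_eq_one_left swapAut_mul_self]; exact hs.mul ih
    · rw [inv_eq_of_mul_eq_one_left (signAut_mul_self s)]; exact (isW1_signAut s).mul ih

theorem exists_mem_signedPerms {l m : Fin 2 × Bool} (h : l.1 ≠ m.1) :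
    ∃ β ∈ signedPerms, β a = mk [l] ∧ β b = mk [m] := by
  obtain ⟨i, e⟩ := l
  obtain ⟨j, f⟩ := m
  fin_cases i <;> fin_cases j
  · simp at h
  · exact ⟨signAut ![e, f], signAut_mem _, signAut_a _, signAut_b _⟩
  · refine ⟨signAut ![f, e] * swapAut, mul_mem (signAut_mem _) swapAut_mem, ?_, ?_⟩
    · rw [MulAut.mul_apply, swapAut_a, signAut_b]; rfl
    · rw [MulAut.mul_apply, swapAut_b, signAut_a]; rfl
  · simp at h

/-- The subgroup generated by the signed permutations, `τ` and the inner automorphisms. -/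
def nielsenGroup : Subgroup (MulAut F2) :=
  Subgroup.closure (insert τ (signedPerms ∪ Set.range MulAut.conj))

theorem mem_signedPerms_of_isW1 {φ : MulAut F2} (h : IsW1 φ) : φ ∈ signedPerms := by
  obtain ⟨l, hl⟩ := mem_letters_iff.mp (isW1_iff.mp h 0)
  obtain ⟨m, hm⟩ := mem_letters_iff.mp (isW1_iff.mp h 1)
  change φ a = mk [l] at hl
  change φ b = mk [m] at hm
  by_cases hlm : l.1 = m.1
  · exfalso
    by_cases h2 : l.2 = m.2
    · have : φ a = φ b := by rw [hl, hm, Prod.ext hlm h2]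
      have := congrArg toWord (φ.injective this)
      simp [a, b] at this
    · have : φ a = φ b⁻¹ := by
        rw [hl, map_inv, hm, ← mk_flip, show l = (m.1, !m.2) from Prod.ext hlm (by simp; grind)]
      have := congrArg toWord (φ.injective this)
      simp [a, b, invRev] at this
  · obtain ⟨β, hβ, h0, h1⟩ := exists_mem_signedPerms hlm
    rwa [aut_ext (hl.trans h0.symm) (hm.trans h1.symm)]

theorem norm_basisLetter (φ : MulAut F2) (l : Fin 2 × Bool) :
    norm (basisLetter φ l) = norm (φ (of l.1)) := by
  obtain ⟨i, e⟩ := l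
  cases e
  · rw [show (i, false) = ((i, true).1, !(i, true).2) from rfl, basisLetter_flip, norm_inv_eq]; rfl
  · rfl

/-- **Nielsen's theorem in rank two**: the automorphism group is generated by the signed
permutations, `τ` and the inner automorphisms. The induction is on the total length of the images of
the generators, which drops as long as the pair is not Nielsen minimal. -/
theorem mem_nielsenGroup (n : ℕ) :
    ∀ φ : MulAut F2, norm (φ a) + norm (φ b) = n → φ ∈ nielsenGroup := by
  induction n using Nat.strong_induction_on with
  | _ n ih =>
  intro φ hn
  have hB : ∀ β ∈ signedPerms, β ∈ nielsenGroup := fun β hβ =>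
    Subgroup.subset_closure (.inr (.inl hβ))
  have hC : ∀ c, MulAut.conj c ∈ nielsenGroup := fun c =>
    Subgroup.subset_closure (.inr (.inr ⟨c, rfl⟩))
  have hτ : τ ∈ nielsenGroup := Subgroup.subset_closure (.inl rfl)
  by_cases hmin : IsNielsenMinimal φ
  · have := hB _ (mem_signedPerms_of_isW1 hmin.isW1_inv)
    exact (Subgroup.inv_mem_iff _).mp this
  · simp only [IsNielsenMinimal] at hmin
    push Not at hmin
    obtain ⟨l, m, hlm, q, hlt⟩ := hmin
    obtain ⟨β, hβ, h0, h1⟩ := exists_mem_signedPerms hlm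
    have hsum : norm (basisLetter φ l) + norm (basisLetter φ m) = n := by
      rw [norm_basisLetter, norm_basisLetter, ← hn]
      obtain ⟨i, e⟩ := l
      obtain ⟨j, f⟩ := m
      fin_cases i <;> fin_cases j <;> simp_all [a, b, add_comm]
    have hmem : MulAut.conj q⁻¹ * φ * β * τ ∈ nielsenGroup := by
      refine ih _ ?_ _ rfl
      rw [← hsum]
      refine lt_of_eq_of_lt ?_ hlt
      simp only [MulAut.mul_apply, τ_a, τ_b, map_mul, h0, h1, MulAut.conj_apply, inv_inv]
      simp only [basisLetter, mul_assoc, mul_inv_cancel_left]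
    have e : φ = (MulAut.conj q⁻¹)⁻¹ * (MulAut.conj q⁻¹ * φ * β * τ) * τ⁻¹ * β⁻¹ := by group
    rw [e]
    exact mul_mem (mul_mem (mul_mem (inv_mem (hC _)) hmem) (inv_mem hτ)) (inv_mem (hB β hβ))

/-! ### Chains -/

/-- The letters of a chain: `σ` and `τ` for the type (C1), where `e = true`, and `σ⁻¹` and `τ⁻¹` for
the type (C2), where `e = false`. The second argument is `true` for the powers of `σ` and `false`
for those of `τ`. -/
def chainGen : Bool → Bool → MulAut F2
  | true, true => σ
  | true, false => τ
  | false, true => σ⁻¹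
  | false, false => τ⁻¹

/-- The chain of type (C1) or (C2), according to `e`, that is spelled by the list `w`. -/
def chainWord (e : Bool) (w : List Bool) : MulAut F2 := (w.map (chainGen e)).prod

theorem chainWord_cons (e x : Bool) (w : List Bool) :
    chainWord e (x :: w) = chainGen e x * chainWord e w := by simp [chainWord]

theorem chainGen_not_mul (e x : Bool) : chainGen (!e) x * chainGen e x = 1 := by
  cases e <;> cases x <;> simp [chainGen]

theorem conj_mul_comm (φ : MulAut F2) (c : F2) : φ * MulAut.conj c = MulAut.conj (φ c) * φ := by
  ext v; simp [MulAut.conj_apply]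

/-- Letters of opposite types can be straightened: `σ⁻¹ τ`, for example, is `ρ σ` up to an inner
automorphism, with the signed permutation `ρ : a ↦ b⁻¹, b ↦ a`. -/
theorem chainGen_not_mul_not (e x : Bool) : ∃ c, ∃ ρ ∈ signedPerms,
    chainGen (!e) x * chainGen e (!x) = MulAut.conj c * ρ * chainGen e x := by
  obtain ⟨ρ, hρ, h0, h1⟩ := exists_mem_signedPerms (l := (1, false)) (m := (0, true)) (by simp)
  obtain ⟨κ, hκ, k0, k1⟩ := exists_mem_signedPerms (l := (1, true)) (m := (0, false)) (by simp)
  cases e <;> cases x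
  · refine ⟨b, ρ, hρ, aut_ext ?_ ?_⟩ <;>
    simp [chainGen, σ_symm_a, σ_symm_b, τ_a, τ_b, τ_symm_a, τ_symm_b, h0, h1, mk_zero_true,
      mk_one_false, mul_assoc]
  · refine ⟨a, κ, hκ, aut_ext ?_ ?_⟩ <;>
    simp [chainGen, σ_symm_a, σ_symm_b, σ_a, σ_b, τ_symm_a, τ_symm_b, k0, k1, mk_zero_false,
      mk_one_true, mul_assoc]
  · refine ⟨a, κ, hκ, aut_ext ?_ ?_⟩ <;>
    simp [chainGen, σ_a, σ_b, τ_a, τ_b, τ_symm_a, τ_symm_b, k0, k1, mk_zero_false, mk_one_true,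
      mul_assoc]
  · refine ⟨b, ρ, hρ, aut_ext ?_ ?_⟩ <;>
    simp [chainGen, σ_symm_a, σ_symm_b, σ_a, σ_b, τ_a, τ_b, h0, h1, mk_zero_true, mk_one_false,
      mul_assoc]

/-- Flipping the sign of exactly one generator exchanges the letters of types (C1) and (C2). -/
theorem chainGen_mul_signAut (e x : Bool) (s : Fin 2 → Bool) : ∃ c,
    chainGen e x * signAut s =
      MulAut.conj c * signAut s * chainGen (e == (s 0 == s 1)) x := by
  refine ⟨if x then (if s 0 then 1 else if e then b⁻¹ else b) else
    (if s 1 then 1 else if e then a⁻¹ else a), ?_⟩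
  cases e <;> cases x <;> cases h0 : s 0 <;> cases h1 : s 1 <;> apply aut_ext <;>
    simp [chainGen, σ_a, σ_b, τ_a, τ_b, σ_symm_a, σ_symm_b, τ_symm_a, τ_symm_b, h0, h1, signAut_a,
      signAut_b, mk_zero_true, mk_zero_false, mk_one_true, mk_one_false, mul_assoc]

theorem chainGen_mul_swapAut (e x : Bool) :
    chainGen e x * swapAut = swapAut * chainGen e (!x) := by
  cases e <;> cases x <;> apply aut_ext <;>
    simp [chainGen, σ_a, σ_b, τ_a, τ_b, σ_symm_a, σ_symm_b, τ_symm_a, τ_symm_b, swapAut_a,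
      swapAut_b]

/-- A letter can be moved past a signed permutation. -/
theorem chainGen_mul_signedPerm {β : MulAut F2} (hβ : β ∈ signedPerms) :
    ∀ e x, ∃ c, ∃ e' x', chainGen e x * β = MulAut.conj c * β * chainGen e' x' := by
  have hswap : ∀ y ∈ signedPerms,
      (∀ e x, ∃ c, ∃ e' x', chainGen e x * y = MulAut.conj c * y * chainGen e' x') →
      ∀ e x, ∃ c, ∃ e' x', chainGen e x * (swapAut * y) =
        MulAut.conj c * (swapAut * y) * chainGen e' x' := by
    intro y _ ih e x
    obtain ⟨c, e', x', h⟩ := ih e (!x)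
    refine ⟨swapAut c, e', x', ?_⟩
    rw [← mul_assoc, chainGen_mul_swapAut, mul_assoc, h, ← mul_assoc, ← mul_assoc, conj_mul_comm]
    group
  have hsign : ∀ s, ∀ y ∈ signedPerms,
      (∀ e x, ∃ c, ∃ e' x', chainGen e x * y = MulAut.conj c * y * chainGen e' x') →
      ∀ e x, ∃ c, ∃ e' x', chainGen e x * (signAut s * y) =
        MulAut.conj c * (signAut s * y) * chainGen e' x' := by
    intro s y _ ih e x
    obtain ⟨d, hf⟩ := chainGen_mul_signAut e x s
    obtain ⟨c, e', x', h⟩ := ih _ x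
    refine ⟨d * signAut s c, e', x', ?_⟩
    rw [← mul_assoc, hf, mul_assoc, h, ← mul_assoc, ← mul_assoc, mul_assoc _ (signAut s),
      conj_mul_comm, _root_.map_mul]
    group
  induction hβ using Subgroup.closure_induction_left with
  | one => exact fun e x => ⟨1, e, x, by simp⟩
  | mul_left x hx y hy ih =>
    rcases hx with rfl | ⟨s, rfl⟩
    · exact hswap y hy ih
    · exact hsign s y hy ih
  | inv_mul_cancel x hx y hy ih =>
    rcases hx with rfl | ⟨s, rfl⟩
    · rw [inv_eq_of_mul_eq_one_left swapAut_mul_self]; exact hswap y hy ih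
    · rw [inv_eq_of_mul_eq_one_left (signAut_mul_self s)]; exact hsign s y hy ih

/-- An automorphism that is a chain followed by a signed permutation, up to an inner
automorphism. -/
def IsChainLike (φ : MulAut F2) : Prop :=
  ∃ c, ∃ β ∈ signedPerms, ∃ e w, φ = MulAut.conj c * β * chainWord e w

theorem IsChainLike.conj_mul {φ : MulAut F2} (h : IsChainLike φ) (d : F2) :
    IsChainLike (MulAut.conj d * φ) := by
  obtain ⟨c, β, hβ, e, w, rfl⟩ := h
  exact ⟨d * c, β, hβ, e, w, by rw [_root_.map_mul]; group⟩

theorem IsChainLike.signedPerm_mul {φ γ : MulAut F2} (h : IsChainLike φ) (hγ : γ ∈ signedPerms) :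
    IsChainLike (γ * φ) := by
  obtain ⟨c, β, hβ, e, w, rfl⟩ := h
  refine ⟨γ c, γ * β, mul_mem hγ hβ, e, w, ?_⟩
  rw [← mul_assoc, ← mul_assoc, conj_mul_comm]
  group

theorem isChainLike_chainGen_mul_chainWord (e x : Bool) (f : Bool) (w : List Bool) :
    IsChainLike (chainGen e x * chainWord f w) := by
  by_cases hef : e = f
  · subst hef
    exact ⟨1, 1, one_mem _, e, x :: w, by simp [chainWord_cons]⟩
  · obtain rfl : e = !f := Bool.eq_not.mpr hef
    cases w with
    | nil => exact ⟨1, 1, one_mem _, !f, [x], by simp [chainWord]⟩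
    | cons y w =>
      rw [chainWord_cons, ← mul_assoc]
      by_cases hxy : y = x
      · subst hxy
        exact ⟨1, 1, one_mem _, f, w, by simp [chainGen_not_mul]⟩
      · obtain rfl : y = !x := Bool.eq_not.mpr hxy
        obtain ⟨c, ρ, hρ, h⟩ := chainGen_not_mul_not f x
        exact ⟨c, ρ, hρ, f, x :: w, by rw [h, chainWord_cons, mul_assoc]⟩

theorem IsChainLike.chainGen_mul {φ : MulAut F2} (h : IsChainLike φ) (e x : Bool) :
    IsChainLike (chainGen e x * φ) := by
  obtain ⟨c, β, hβ, f, w, rfl⟩ := h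
  obtain ⟨d, e', x', hd⟩ := chainGen_mul_signedPerm hβ e x
  have : chainGen e x * (MulAut.conj c * β * chainWord f w) =
      MulAut.conj (chainGen e x c * d) * (β * (chainGen e' x' * chainWord f w)) := by
    rw [← mul_assoc, ← mul_assoc, conj_mul_comm, mul_assoc (MulAut.conj _), hd, _root_.map_mul]
    group
  rw [this]
  exact ((isChainLike_chainGen_mul_chainWord e' x' f w).signedPerm_mul hβ).conj_mul _

/-- Every automorphism of the free group of rank two is, up to an inner automorphism, a chain of
type (C1) or (C2) followed by a signed permutation of the generators. -/
theorem isChainLike (φ : MulAut F2) : IsChainLike φ := by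
  have hφ := mem_nielsenGroup _ φ rfl
  induction hφ using Subgroup.closure_induction_left with
  | one => exact ⟨1, 1, one_mem _, true, [], by simp [chainWord]⟩
  | mul_left x hx y _ ih =>
    rcases hx with rfl | hx | ⟨c, rfl⟩
    · exact ih.chainGen_mul true false
    · exact ih.signedPerm_mul hx
    · exact ih.conj_mul c
  | inv_mul_cancel x hx y _ ih =>
    rcases hx with rfl | hx | ⟨c, rfl⟩
    · exact ih.chainGen_mul false false
    · exact ih.signedPerm_mul (inv_mem hx)
    · rw [← _root_.map_inv]; exact ih.conj_mul c⁻¹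

/-! ### The cost of a cyclic word -/

/-- The flag of a letter `y` that follows a letter `s.1` with flag `s.2`. The flag of a letter tells
whether its maximal run (power of a generator) is entered through a *negative turn*, that is,
from a letter with the opposite exponent. -/
def stepFlag (s : (Fin 2 × Bool) × Bool) (y : Fin 2 × Bool) : Bool :=
  if s.1.1 = y.1 then s.2 else s.1.2 != y.2

/-- The letter and flag reached by reading the word `L` from the letter and flag `s`. -/
def runEnd (s : (Fin 2 × Bool) × Bool) (L : List (Fin 2 × Bool)) : (Fin 2 × Bool) × Bool :=
  L.foldl (fun s y => (y, stepFlag s y)) s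

/-- The number of flagged letters of the word `L` that is read from the letter and flag `s`. -/
def runCost : (Fin 2 × Bool) × Bool → List (Fin 2 × Bool) → ℕ
  | _, [] => 0
  | s, y :: L => (stepFlag s y).toNat + runCost (y, stepFlag s y) L

theorem runEnd_cons (s : (Fin 2 × Bool) × Bool) (y : Fin 2 × Bool) (L : List (Fin 2 × Bool)) :
    runEnd s (y :: L) = runEnd (y, stepFlag s y) L := rfl

theorem runEnd_append (s : (Fin 2 × Bool) × Bool) (L₁ L₂ : List (Fin 2 × Bool)) :
    runEnd s (L₁ ++ L₂) = runEnd (runEnd s L₁) L₂ := List.foldl_append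

theorem runCost_append (s : (Fin 2 × Bool) × Bool) (L₁ L₂ : List (Fin 2 × Bool)) :
    runCost s (L₁ ++ L₂) = runCost s L₁ + runCost (runEnd s L₁) L₂ := by
  induction L₁ generalizing s with
  | nil => simp [runCost, runEnd]
  | cons y L ih => simp only [List.cons_append, runCost, ih, runEnd_cons]; omega

theorem runCost_le (s : (Fin 2 × Bool) × Bool) (L : List (Fin 2 × Bool)) :
    runCost s L ≤ L.length := by
  induction L generalizing s with
  | nil => simp [runCost]
  | cons y L ih =>
    have := ih (y, stepFlag s y)
    have := (stepFlag s y).toNat_le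
    simp only [runCost, List.length_cons]
    omega

/-- `HasCost L r`: in a consistent flagging of the cyclic word `L`, exactly `r` letters are flagged,
that is, lie in a run entered through a negative turn. For a power of a single generator both
constant flaggings are consistent; in all other cases there is exactly one. -/
def HasCost (L : List (Fin 2 × Bool)) (r : ℕ) : Prop :=
  ∃ s, runEnd s L = s ∧ runCost s L = r

theorem HasCost.append_comm {L₁ L₂ : List (Fin 2 × Bool)} {r : ℕ} (h : HasCost (L₁ ++ L₂) r) :
    HasCost (L₂ ++ L₁) r := by
  obtain ⟨s, h1, rfl⟩ := h
  rw [runEnd_append] at h1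
  refine ⟨runEnd s L₁, ?_, ?_⟩
  · rw [runEnd_append, h1]
  · rw [runCost_append, runCost_append, h1, add_comm]

theorem HasCost.isRotated {L L' : List (Fin 2 × Bool)} {r : ℕ} (h : HasCost L r) (hr : L ~r L') :
    HasCost L' r := by
  obtain ⟨n, rfl⟩ := hr
  rw [List.rotate_eq_drop_append_take_mod]
  apply HasCost.append_comm
  rwa [List.take_append_drop]

/-- The final flag either equals the initial one or does not depend on it. -/
theorem runEnd_flag (L : List (Fin 2 × Bool)) (x : Fin 2 × Bool) :
    (∀ f, (runEnd (x, f) L).2 = f) ∨ ∃ g, ∀ f, (runEnd (x, f) L).2 = g := by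
  induction L generalizing x with
  | nil => exact .inl fun f => rfl
  | cons y L ih =>
    by_cases h : x.1 = y.1
    · simpa [runEnd_cons, stepFlag, h] using ih y
    · exact .inr ⟨_, fun f => by simp only [runEnd_cons, stepFlag, h, if_false]; rfl⟩

theorem runEnd_concat_fst (s : (Fin 2 × Bool) × Bool) (L : List (Fin 2 × Bool)) (x : Fin 2 × Bool) :
    (runEnd s (L ++ [x])).1 = x := by
  simp [runEnd]

theorem exists_runEnd_eq (L : List (Fin 2 × Bool)) (x : Fin 2 × Bool) :
    ∃ f, runEnd (x, f) (L ++ [x]) = (x, f) := by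
  rcases runEnd_flag (L ++ [x]) x with h | ⟨g, h⟩
  · exact ⟨true, Prod.ext (runEnd_concat_fst _ _ _) (h true)⟩
  · exact ⟨g, Prod.ext (runEnd_concat_fst _ _ _) (h g)⟩

theorem exists_hasCost (L : List (Fin 2 × Bool)) : ∃ r ≤ L.length, HasCost L r := by
  rcases List.eq_nil_or_concat L with rfl | ⟨L, x, rfl⟩
  · exact ⟨0, le_rfl, ((0, true), true), rfl, rfl⟩
  · rw [List.concat_eq_append]
    obtain ⟨f, hf⟩ := exists_runEnd_eq L x
    exact ⟨_, runCost_le _ _, _, hf, rfl⟩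

/-! ### Block form of a cyclic word -/

/-- The word `b ^ n`. -/
def bWord (n : ℤ) : List (Fin 2 × Bool) := List.replicate n.natAbs (1, decide (0 < n))

/-- The word `b ^ n₁ a ^ ε₁ ⋯ b ^ n_k a ^ ε_k` for the list of the blocks `(n_i, ε_i)`, where the
sign `ε_i` is encoded by a Boolean. -/
def blockWord (D : List (ℤ × Bool)) : List (Fin 2 × Bool) :=
  D.flatMap fun p => bWord p.1 ++ [(0, p.2)]

theorem blockWord_cons (p : ℤ × Bool) (D : List (ℤ × Bool)) :
    blockWord (p :: D) = bWord p.1 ++ (0, p.2) :: blockWord D := by simp [blockWord]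

theorem blockWord_append (D E : List (ℤ × Bool)) :
    blockWord (D ++ E) = blockWord D ++ blockWord E := by simp [blockWord]

theorem bWord_zero : bWord 0 = [] := rfl

theorem bWord_of_ne_zero {n : ℤ} (h : n ≠ 0) :
    bWord n = (1, decide (0 < n)) :: List.replicate (n.natAbs - 1) (1, decide (0 < n)) := by
  rw [bWord, ← List.replicate_succ]
  congr
  omega

theorem bWord_of_ne_zero' {n : ℤ} (h : n ≠ 0) :
    bWord n = List.replicate (n.natAbs - 1) (1, decide (0 < n)) ++ [(1, decide (0 < n))] := by
  rw [bWord, ← List.replicate_succ']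
  congr
  omega

/-- The sign of the last block, or `ε` if there is none. -/
def lastSign (ε : Bool) (D : List (ℤ × Bool)) : Bool := D.foldl (fun _ p => p.2) ε

theorem lastSign_cons (ε : Bool) (p : ℤ × Bool) (D : List (ℤ × Bool)) :
    lastSign ε (p :: D) = lastSign p.2 D := rfl

theorem lastSign_append (ε : Bool) (D E : List (ℤ × Bool)) :
    lastSign ε (D ++ E) = lastSign (lastSign ε D) E := List.foldl_append

/-- The blocks, read after a letter `a ^ ε`, spell a reduced word. -/
def BlockReduced : Bool → List (ℤ × Bool) → Prop
  | _, [] => True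
  | ε, p :: D => (p.1 = 0 → ε = p.2) ∧ BlockReduced p.2 D

theorem blockReduced_append (ε : Bool) (D E : List (ℤ × Bool)) :
    BlockReduced ε (D ++ E) ↔ BlockReduced ε D ∧ BlockReduced (lastSign ε D) E := by
  induction D generalizing ε with
  | nil => simp [BlockReduced, lastSign]
  | cons p D ih => simp only [List.cons_append, BlockReduced, ih, lastSign_cons]; tauto

theorem isReduced_bWord_append {x : Fin 2 × Bool} (hx : x.1 = 0) (n : ℤ) {e : Bool}
    {L : List (Fin 2 × Bool)} :
    IsReduced (x :: (bWord n ++ (0, e) :: L)) ↔ (n = 0 → x.2 = e) ∧ IsReduced ((0, e) :: L) := by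
  by_cases h : n = 0
  · subst h
    simp only [bWord_zero, List.nil_append]
    rw [isReduced_cons_cons_iff]
    simp [hx]
  · have : ∀ (k : ℕ) (s : Bool) , IsReduced ((1, s) :: (List.replicate k (1, s) ++ (0, e) :: L)) ↔
        IsReduced ((0, e) :: L) := by
      intro k s
      induction k with
      | zero => simp
      | succ k ih => rw [List.replicate_succ, List.cons_append, isReduced_cons_cons_iff, ih]; simp
    rw [bWord_of_ne_zero h, List.cons_append, isReduced_cons_cons_iff, this]
    simp [hx, h]

theorem isReduced_blockWord_iff (ε : Bool) (D : List (ℤ × Bool)) :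
    IsReduced ((0, ε) :: blockWord D) ↔ BlockReduced ε D := by
  induction D generalizing ε with
  | nil => simp [blockWord, BlockReduced, FreeGroup.IsReduced]
  | cons p D ih => rw [blockWord_cons, isReduced_bWord_append rfl, ih, BlockReduced]

theorem blockWord_eq_concat (ε : Bool) {D : List (ℤ × Bool)} (hD : D ≠ []) :
    ∃ M, blockWord D = M ++ [(0, lastSign ε D)] := by
  rcases List.eq_nil_or_concat D with rfl | ⟨E, p, rfl⟩
  · exact absurd rfl hD
  · refine ⟨blockWord E ++ bWord p.1, ?_⟩
    simp [lastSign, blockWord]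

theorem isCyclicallyReduced_blockWord_iff {ε : Bool} {D : List (ℤ × Bool)} (hD : D ≠ [])
    (hε : lastSign ε D = ε) : IsCyclicallyReduced (blockWord D) ↔ BlockReduced ε D := by
  obtain ⟨M, hM⟩ := blockWord_eq_concat ε hD
  rw [← isReduced_blockWord_iff, hM, hε, isCyclicallyReduced_concat_iff]

/-- Every reduced word has a block form, up to a power of `b` at its end. -/
theorem exists_blockWord_append_bWord (L : List (Fin 2 × Bool)) (hL : IsReduced L) :
    ∃ D n, L = blockWord D ++ bWord n := by
  induction L using List.reverseRecOn with
  | nil => exact ⟨[], 0, rfl⟩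
  | append_singleton L x ih =>
    obtain ⟨D, n, h⟩ := ih (hL.infix ⟨[], [x], by simp⟩)
    obtain ⟨i, e⟩ := x
    by_cases hi : i = 0
    · subst hi
      exact ⟨D ++ [(n, e)], 0, by simp [h, bWord_zero, blockWord]⟩
    · obtain rfl : i = 1 := by omega
      by_cases hn : n = 0
      · subst hn
        refine ⟨D, if e then 1 else -1, ?_⟩
        rw [h, bWord_zero]
        cases e <;> simp [bWord]
      · have he : decide (0 < n) = e := by
          rw [h, bWord_of_ne_zero' hn, ← List.append_assoc, List.append_assoc] at hL
          have := hL.infix ⟨_, [], List.append_nil _⟩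
          simpa [FreeGroup.IsReduced] using this
        refine ⟨D, if e then n + 1 else n - 1, ?_⟩
        rw [h, List.append_assoc, bWord, he, ← List.replicate_succ', bWord]
        congr 2
        · cases e <;> simp at he ⊢ <;> omega
        · cases e <;> simp at he ⊢ <;> omega

theorem exists_blockWord_of_concat {L : List (Fin 2 × Bool)} {e : Bool}
    (hL : IsReduced (L ++ [(0, e)])) : ∃ D, D ≠ [] ∧ L ++ [(0, e)] = blockWord D := by
  obtain ⟨D, n, h⟩ := exists_blockWord_append_bWord L (hL.infix ⟨[], [(0, e)], by simp⟩)
  exact ⟨D ++ [(n, e)], by simp, by simp [h, blockWord]⟩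

/-- A closed block form: nonempty, reduced, and read from the sign `ε` of its last block. -/
structure IsClosedForm (ε : Bool) (D : List (ℤ × Bool)) : Prop where
  ne_nil : D ≠ []
  lastSign_eq : lastSign ε D = ε
  reduced : BlockReduced ε D

theorem IsClosedForm.isCyclicallyReduced {ε : Bool} {D : List (ℤ × Bool)} (h : IsClosedForm ε D) :
    IsCyclicallyReduced (blockWord D) :=
  (isCyclicallyReduced_blockWord_iff h.ne_nil h.lastSign_eq).mpr h.reduced

theorem isClosedForm_of_concat {L : List (Fin 2 × Bool)} {e : Bool} {D : List (ℤ × Bool)}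
    (hL : IsCyclicallyReduced (L ++ [(0, e)])) (h : L ++ [(0, e)] = blockWord D) :
    IsClosedForm e D := by
  have hD : D ≠ [] := by rintro rfl; simp [blockWord] at h
  obtain ⟨M, hM⟩ := blockWord_eq_concat e hD
  have he : lastSign e D = e := by
    rw [hM] at h
    have := (List.append_inj' h rfl).2
    simpa using this.symm
  refine ⟨hD, he, ?_⟩
  rw [← isCyclicallyReduced_blockWord_iff hD he, ← h]
  exact hL

/-- A cyclically reduced word that is not a power of `b` has a closed block form. -/
theorem coherent_or_exists_isClosedForm {L : List (Fin 2 × Bool)} (hL : IsCyclicallyReduced L) :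
    Coherent L ∨ ∃ ε D, IsClosedForm ε D ∧ L ~r blockWord D := by
  obtain ⟨D, n, h⟩ := exists_blockWord_append_bWord L hL.isReduced
  by_cases hD : D = []
  · left
    subst hD
    intro x hx y hy _
    rw [h] at hx hy
    simp only [blockWord, bWord, List.flatMap_nil, List.nil_append, List.mem_replicate] at hx hy
    rw [hx.2, hy.2]
  · right
    obtain ⟨M, hM⟩ := blockWord_eq_concat true hD
    have hr : L ~r (bWord n ++ M) ++ [(0, lastSign true D)] := by
      rw [h, List.append_assoc, ← hM]
      exact List.isRotated_append
    have hcr := hL.isRotated hr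
    obtain ⟨E, -, hE⟩ := exists_blockWord_of_concat hcr.isReduced
    exact ⟨_, E, isClosedForm_of_concat hcr hE, hE ▸ hr⟩

/-- The flag of the letter `a ^ p.2` at the end of the block `p`, if `f` is the flag of the
`a`-letter before the block. -/
def blockFlag (f : Bool) (p : ℤ × Bool) : Bool := if p.1 = 0 then f else decide (0 < p.1) != p.2

/-- The sign and the flag of the last `a`-letter. -/
def blockEnd (s : Bool × Bool) (D : List (ℤ × Bool)) : Bool × Bool :=
  D.foldl (fun s p => (p.2, blockFlag s.2 p)) s

/-- The number of flagged letters of `blockWord D`, read from the sign and flag `s`. -/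
def blockCost : Bool × Bool → List (ℤ × Bool) → ℕ
  | _, [] => 0
  | s, p :: D => (if s.1 = decide (0 < p.1) then 0 else p.1.natAbs) + (blockFlag s.2 p).toNat +
      blockCost (p.2, blockFlag s.2 p) D

theorem run_replicate (s : Bool) (f : Bool) (k : ℕ) :
    runEnd ((1, s), f) (List.replicate k (1, s)) = ((1, s), f) ∧
      runCost ((1, s), f) (List.replicate k (1, s)) = k * f.toNat := by
  induction k with
  | zero => simp [runEnd, runCost]
  | succ k ih =>
    rw [List.replicate_succ, runEnd_cons, runCost]
    simp only [stepFlag, if_true, ih, true_and]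
    ring

theorem run_bWord_append (ε f : Bool) (p : ℤ × Bool) (L : List (Fin 2 × Bool)) :
    runEnd ((0, ε), f) (bWord p.1 ++ (0, p.2) :: L) = runEnd ((0, p.2), blockFlag f p) L ∧
      runCost ((0, ε), f) (bWord p.1 ++ (0, p.2) :: L) =
        (if ε = decide (0 < p.1) then 0 else p.1.natAbs) + (blockFlag f p).toNat +
          runCost ((0, p.2), blockFlag f p) L := by
  by_cases h : p.1 = 0
  · simp [h, bWord_zero, runEnd_cons, runCost, stepFlag, blockFlag]
  · rw [bWord_of_ne_zero h, List.cons_append, runEnd_cons, runCost, runEnd_append, runCost_append]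
    have hs : stepFlag ((0, ε), f) (1, decide (0 < p.1)) = (ε != decide (0 < p.1)) := by
      simp [stepFlag]
    rw [hs, (run_replicate _ _ _).1, (run_replicate _ _ _).2, runEnd_cons, runCost]
    have hb : ∀ g, stepFlag ((1, decide (0 < p.1)), g) (0, p.2) = blockFlag f p := by
      intro g; simp [stepFlag, blockFlag, h]
    rw [hb]
    refine ⟨rfl, ?_⟩
    by_cases he : ε = decide (0 < p.1)
    · simp [he]
    · have : (ε != decide (0 < p.1)) = true := by simp [bne_iff_ne, he]
      rw [this, if_neg he]
      simp only [Bool.toNat_true]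
      omega

theorem run_blockWord (s : Bool × Bool) (D : List (ℤ × Bool)) :
    runEnd ((0, s.1), s.2) (blockWord D) = ((0, (blockEnd s D).1), (blockEnd s D).2) ∧
      runCost ((0, s.1), s.2) (blockWord D) = blockCost s D := by
  induction D generalizing s with
  | nil => simp [runEnd, runCost, blockWord, blockEnd, blockCost]
  | cons p D ih =>
    rw [blockWord_cons, (run_bWord_append _ _ _ _).1, (run_bWord_append _ _ _ _).2, blockCost]
    have := ih (p.2, blockFlag s.2 p)
    exact ⟨this.1, by rw [this.2]⟩

theorem blockEnd_fst (s : Bool × Bool) (D : List (ℤ × Bool)) :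
    (blockEnd s D).1 = lastSign s.1 D := by
  induction D generalizing s with
  | nil => rfl
  | cons p D ih => exact ih _

theorem blockEnd_append (s : Bool × Bool) (D E : List (ℤ × Bool)) :
    blockEnd s (D ++ E) = blockEnd (blockEnd s D) E := List.foldl_append

theorem IsClosedForm.hasCost_iff {ε : Bool} {D : List (ℤ × Bool)} (h : IsClosedForm ε D) (r : ℕ) :
    HasCost (blockWord D) r ↔ ∃ f, blockEnd (ε, f) D = (ε, f) ∧ blockCost (ε, f) D = r := by
  constructor
  · rintro ⟨⟨x, f⟩, h1, h2⟩
    obtain ⟨M, hM⟩ := blockWord_eq_concat ε h.ne_nil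
    have hx : x = (0, ε) := by
      have := runEnd_concat_fst (x, f) M (0, lastSign ε D)
      rw [← hM, h1, h.lastSign_eq] at this
      exact this
    subst hx
    rw [(run_blockWord (ε, f) D).1] at h1
    rw [(run_blockWord (ε, f) D).2] at h2
    refine ⟨f, Prod.ext ?_ (Prod.ext_iff.mp h1).2, h2⟩
    rw [blockEnd_fst]; exact h.lastSign_eq
  · rintro ⟨f, h1, h2⟩
    refine ⟨((0, ε), f), ?_, ?_⟩
    · rw [(run_blockWord (ε, f) D).1, h1]
    · rw [(run_blockWord (ε, f) D).2, h2]

/-! ### The action of `σ` on block forms -/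

theorem mk_replicate (i : Fin 2) (e : Bool) (k : ℕ) :
    (mk (List.replicate k (i, e)) : F2) = mk [(i, e)] ^ k := by
  induction k with
  | zero => simp [one_eq_mk]
  | succ k ih => rw [List.replicate_succ, ← List.singleton_append, ← mul_mk, ih, pow_succ']

theorem mk_bWord (n : ℤ) : (mk (bWord n) : F2) = b ^ n := by
  rw [bWord, mk_replicate]
  by_cases h : 0 < n
  · rw [decide_eq_true h, mk_one_true, ← zpow_natCast]
    congr 1; omega
  · rw [decide_eq_false h, mk_one_false, inv_pow, ← zpow_natCast, ← zpow_neg]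
    congr 1; omega

/-- The exponent of the power of `b` that `σ` puts on the right of `a ^ ε`; on the left it puts
`b ^ (sideExp ε - 1)`. -/
def sideExp (ε : Bool) : ℤ := if ε then 1 else 0

/-- The action of `σ` on block forms. -/
def shift : Bool → List (ℤ × Bool) → List (ℤ × Bool)
  | _, [] => []
  | ε, p :: D => (p.1 + sideExp ε + sideExp p.2 - 1, p.2) :: shift p.2 D

theorem shift_append (ε : Bool) (D E : List (ℤ × Bool)) :
    shift ε (D ++ E) = shift ε D ++ shift (lastSign ε D) E := by
  induction D generalizing ε with
  | nil => rfl
  | cons p D ih => simp [shift, ih, lastSign_cons]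

theorem lastSign_shift (ε ε' : Bool) (D : List (ℤ × Bool)) :
    lastSign ε (shift ε' D) = lastSign ε D := by
  induction D generalizing ε ε' with
  | nil => rfl
  | cons p D ih => simp only [shift, lastSign_cons, ih]

theorem BlockReduced.shift {ε : Bool} {D : List (ℤ × Bool)} (h : BlockReduced ε D) :
    BlockReduced ε (shift ε D) := by
  induction D generalizing ε with
  | nil => trivial
  | cons p D ih =>
    refine ⟨fun h0 => ?_, ih h.2⟩
    have := h.1
    obtain ⟨n, e⟩ := p
    cases ε <;> cases e <;> simp [sideExp] at * <;> omega

theorem IsClosedForm.shift {ε : Bool} {D : List (ℤ × Bool)} (h : IsClosedForm ε D) :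
    IsClosedForm ε (shift ε D) where
  ne_nil := by
    obtain ⟨p, E, rfl⟩ := List.exists_cons_of_ne_nil h.ne_nil
    simp [F2.shift]
  lastSign_eq := by rw [lastSign_shift]; exact h.lastSign_eq
  reduced := h.reduced.shift

theorem mk_blockWord_cons (p : ℤ × Bool) (D : List (ℤ × Bool)) :
    (mk (blockWord (p :: D)) : F2) = b ^ p.1 * mk [(0, p.2)] * mk (blockWord D) := by
  rw [blockWord_cons, ← List.singleton_append (l := blockWord D), ← mul_mk, ← mul_mk, mk_bWord,
    mul_assoc]

theorem σ_mk_zero (ε : Bool) :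
    σ (mk [(0, ε)]) = b ^ (sideExp ε - 1) * mk [(0, ε)] * b ^ sideExp ε := by
  cases ε
  · rw [mk_zero_false, map_inv, σ_a]; simp [sideExp]
  · rw [mk_zero_true, σ_a]; simp [sideExp]

theorem σ_mk_blockWord (ε : Bool) (D : List (ℤ × Bool)) :
    σ (mk (blockWord D)) =
      b ^ (-sideExp ε) * mk (blockWord (shift ε D)) * b ^ sideExp (lastSign ε D) := by
  induction D generalizing ε with
  | nil => simp [blockWord, shift, lastSign, ← one_eq_mk]
  | cons p D ih =>
    rw [shift, mk_blockWord_cons, mk_blockWord_cons, map_mul, map_mul, map_zpow, σ_b, σ_mk_zero,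
      ih p.2, lastSign_cons]
    simp only [sub_eq_add_neg, zpow_add]
    group

theorem IsClosedForm.isConj_σ {ε : Bool} {D : List (ℤ × Bool)} (h : IsClosedForm ε D) :
    IsConj (σ (FreeGroup.mk (blockWord D))) (FreeGroup.mk (blockWord (F2.shift ε D))) := by
  rw [σ_mk_blockWord ε D, h.lastSign_eq, isConj_iff]
  exact ⟨b ^ sideExp ε, by group⟩

/-- The blocks, read from the sign and flag `s`, on which `σ` does not lower the cost: there is no
`a b⁻ⁿ a` and no `a⁻¹ bⁿ a⁻¹` with `n > 0`, and a letter that follows an equal letter is not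
flagged. -/
def IsStuck : Bool × Bool → List (ℤ × Bool) → Prop
  | _, [] => True
  | s, p :: D => (p.1 = 0 → s.2 = false) ∧ (p.1 ≠ 0 → s.1 = p.2 → decide (0 < p.1) = s.1) ∧
      IsStuck (p.2, blockFlag s.2 p) D

theorem isStuck_append (s : Bool × Bool) (D E : List (ℤ × Bool)) :
    IsStuck s (D ++ E) ↔ IsStuck s D ∧ IsStuck (blockEnd s D) E := by
  induction D generalizing s with
  | nil => simp [IsStuck, blockEnd]
  | cons p D ih =>
    have : blockEnd s (p :: D) = blockEnd (p.2, blockFlag s.2 p) D := rfl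
    simp only [List.cons_append, IsStuck, ih, this]; tauto

/-- `σ` does not raise the cost, and keeps it only if the word is stuck. The flags `f`, `f'` of the
initial letter before and after `σ` are unrelated. -/
theorem blockCost_shift_le {ε : Bool} {D : List (ℤ × Bool)} (h : BlockReduced ε D) (f f' : Bool) :
    blockCost (ε, f') (shift ε D) ≤ blockCost (ε, f) D ∧
      (blockCost (ε, f') (shift ε D) = blockCost (ε, f) D → IsStuck (ε, f) D) := by
  induction D generalizing ε f f' with
  | nil => simp [shift, blockCost, IsStuck]
  | cons p D ih =>
    obtain ⟨n, e⟩ := p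
    simp only [shift, blockCost, IsStuck]
    set n' := n + sideExp ε + sideExp e - 1 with hn'
    obtain ⟨ih1, ih2⟩ := ih h.2 (blockFlag f (n, e)) (blockFlag f' (n', e))
    dsimp only at ih1 ih2
    have hred := h.1
    have key : (if ε = decide (0 < n') then 0 else n'.natAbs) + (blockFlag f' (n', e)).toNat ≤
          (if ε = decide (0 < n) then 0 else n.natAbs) + (blockFlag f (n, e)).toNat ∧
        ((if ε = decide (0 < n') then 0 else n'.natAbs) + (blockFlag f' (n', e)).toNat =
          (if ε = decide (0 < n) then 0 else n.natAbs) + (blockFlag f (n, e)).toNat →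
          (n = 0 → f = false) ∧ (n ≠ 0 → ε = e → decide (0 < n) = ε)) := by
      clear ih1 ih2 ih h
      by_cases h0 : n = 0
      · subst h0
        obtain rfl : ε = e := hred rfl
        cases ε <;> cases f <;> simp [blockFlag, hn', sideExp]
      · by_cases he : ε = e
        · subst he
          have hb : (blockFlag f' (n', ε)).toNat ≤ 1 := Bool.toNat_le _
          cases ε
          · have e1 : n' = n - 1 := by simp [hn', sideExp]
            by_cases hpos : 0 < n
            · by_cases h1 : n = 1
              · subst h1
                simp [e1, blockFlag] at hb ⊢
                cases f' <;> simp
              · simp [e1, blockFlag, h0, hpos, show 1 < n by omega, show n - 1 ≠ 0 by omega]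
                omega
            · simp [e1, blockFlag, h0, hpos, show ¬ 1 < n by omega, show n - 1 ≠ 0 by omega]
          · have e1 : n' = n + 1 := by simp [hn', sideExp]
            by_cases hpos : 0 < n
            · simp [e1, blockFlag, h0, hpos, show 0 < n + 1 by omega, show n + 1 ≠ 0 by omega]
            · by_cases h1 : n = -1
              · subst h1
                simp [e1, blockFlag] at hb ⊢
                cases f' <;> simp
              · simp [e1, blockFlag, h0, hpos, show ¬ 0 < n + 1 by omega, show n + 1 ≠ 0 by omega]
                omega
        · have e1 : n' = n := by cases ε <;> cases e <;> simp_all [sideExp]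
          rw [e1]
          simp [blockFlag, h0, he]
    refine ⟨by omega, fun heq => ?_⟩
    have h1 := key.2 (by omega)
    exact ⟨h1.1, h1.2, ih2 (by omega)⟩

/-! ### Persistent negative turns -/

/-- The word contains `x yᵏ x⁻ⁿ y⁻¹` with `k, n > 0`, where `x`, `y` are the two generators in
either order, or their inverses. Both `σ` and `τ` map such a word to one that contains a subword of
the same form, so the turn from `yᵏ` to `x⁻ⁿ` survives every chain of type (C1). -/
def HasPersistentTurn (L : List (Fin 2 × Bool)) : Prop :=
  ∃ (i j : Fin 2) (e : Bool) (k n : ℕ), i ≠ j ∧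
    ((i, e) :: (List.replicate (k + 1) (j, e) ++ List.replicate (n + 1) (i, !e) ++ [(j, !e)]))
      <:+: L

/-- The cyclic word contains a persistent turn. -/
def IsPersistent (L : List (Fin 2 × Bool)) : Prop := ∃ L', L ~r L' ∧ HasPersistentTurn L'

theorem HasPersistentTurn.of_infix {L L' : List (Fin 2 × Bool)} (h : HasPersistentTurn L)
    (h' : L <:+: L') : HasPersistentTurn L' := by
  obtain ⟨i, j, e, k, n, hij, hL⟩ := h
  exact ⟨i, j, e, k, n, hij, hL.trans h'⟩

theorem IsPersistent.isRotated {L L' : List (Fin 2 × Bool)} (h : IsPersistent L) (hr : L ~r L') :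
    IsPersistent L' := by
  obtain ⟨M, hM, hp⟩ := h
  exact ⟨M, hr.symm.trans hM, hp⟩

theorem IsPersistent.not_coherent {L : List (Fin 2 × Bool)} (h : IsPersistent L) :
    ¬ Coherent L := by
  obtain ⟨M, hM, i, j, e, k, n, hij, hinf⟩ := h
  intro hc
  have h1 : (j, e) ∈ L := hM.mem_iff.mpr (hinf.subset (by simp))
  have h2 : (j, !e) ∈ L := hM.mem_iff.mpr (hinf.subset (by simp))
  simpa using hc _ h1 _ h2 rfl

theorem blockWord_replicate_zero (k : ℕ) (e : Bool) :
    blockWord (List.replicate k (0, e)) = List.replicate k (0, e) := by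
  induction k with
  | zero => rfl
  | succ k ih => rw [List.replicate_succ, blockWord_cons, ih]; rfl

theorem shift_replicate_zero (k : ℕ) (e : Bool) :
    shift e (List.replicate k (0, e)) = List.replicate k (if e then 1 else -1, e) := by
  induction k with
  | zero => rfl
  | succ k ih =>
    rw [List.replicate_succ, shift, ih, List.replicate_succ]
    cases e <;> simp [sideExp]

theorem lastSign_replicate (k : ℕ) (n : ℤ) (e : Bool) :
    lastSign e (List.replicate k (n, e)) = e := by
  induction k with
  | zero => rfl
  | succ k ih => rw [List.replicate_succ, lastSign_cons, ih]

/-- The exponent `± n` of sign `e`. -/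
def signedExp (e : Bool) (n : ℕ) : ℤ := if e then n else -n

theorem bWord_signedExp (e : Bool) (n : ℕ) :
    bWord (signedExp e (n + 1)) = List.replicate (n + 1) (1, e) := by
  cases e <;> simp [bWord, signedExp] <;> omega

theorem ne_zero_and_sign_eq_of_concat {D : List (ℤ × Bool)} {m : ℤ} {t : List (Fin 2 × Bool)}
    {e : Bool} (h : t ++ [(1, e)] = blockWord D ++ bWord m) : m ≠ 0 ∧ decide (0 < m) = e := by
  by_cases hm : m = 0
  · subst hm
    rw [bWord_zero, List.append_nil] at h
    by_cases hD : D = []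
    · subst hD; simp [blockWord] at h
    · obtain ⟨M, hM⟩ := blockWord_eq_concat true hD
      rw [hM] at h
      have := (List.append_inj' h rfl).2
      simp at this
  · refine ⟨hm, ?_⟩
    rw [bWord_of_ne_zero' hm, ← List.append_assoc] at h
    have := (List.append_inj' h rfl).2
    simpa using this.symm

/-- `σ` preserves persistent turns: the cyclic word is rotated so that a persistent turn lies across
its ends, or at its beginning, and the shifted block form is computed there. -/
theorem IsPersistent.exists_isClosedForm {L : List (Fin 2 × Bool)} (h : IsPersistent L)
    (hL : IsCyclicallyReduced L) : ∃ ε D, IsClosedForm ε D ∧ L ~r blockWord D ∧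
      IsPersistent (blockWord (shift ε D)) := by
  obtain ⟨M, hM, i, j, e, k, n, hij, u, v, huv⟩ := h
  have hrot : L ~r ((i, e) :: (List.replicate (k + 1) (j, e) ++ List.replicate (n + 1) (i, !e) ++
      [(j, !e)])) ++ (v ++ u) := by
    refine hM.trans ?_
    rw [← huv, List.append_assoc, ← List.append_assoc _ v u]
    exact List.isRotated_append
  generalize v ++ u = t at hrot
  by_cases hi : i = 0
  · -- the turn of `a ^ e b ^ (e (k + 1)) a ^ (-e (n + 1)) b ^ (-e)`; if `n > 0`, then `σ`
    -- puts the new letter `b ^ (-e)` between the first two letters `a ^ (-e)`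
    obtain rfl := hi
    obtain rfl : j = 1 := by omega
    have hrot2 : L ~r (List.replicate (k + 1) (1, e) ++ (List.replicate (n + 1) (0, !e) ++
        ((1, !e) :: t))) ++ [(0, e)] := by
      refine hrot.trans ?_
      have := List.isRotated_append (l := [((0 : Fin 2), e)])
        (l' := List.replicate (k + 1) (1, e) ++ (List.replicate (n + 1) (0, !e) ++ ((1, !e) :: t)))
      simpa using this
    have hcr := hL.isRotated hrot2
    obtain ⟨D', hD', hDe⟩ := exists_blockWord_of_concat (L := (1, !e) :: t) (e := e)
      (hcr.isReduced.infix ⟨List.replicate (k + 1) (1, e) ++ List.replicate (n + 1) (0, !e), [],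
        by simp⟩)
    obtain ⟨⟨m, ε'⟩, D'', rfl⟩ := List.exists_cons_of_ne_nil hD'
    have hm : m ≠ 0 ∧ decide (0 < m) = !e := by
      rw [blockWord_cons] at hDe
      by_cases hm : m = 0
      · subst hm; simp [bWord_zero] at hDe
      · refine ⟨hm, ?_⟩
        rw [bWord_of_ne_zero hm] at hDe
        simp only [List.cons_append, List.cons.injEq, Prod.mk.injEq, true_and] at hDe
        exact hDe.1.symm
    set D := (signedExp e (k + 1), !e) :: (List.replicate n (0, !e) ++ (m, ε') :: D'') with hD
    have hword : (List.replicate (k + 1) (1, e) ++ (List.replicate (n + 1) (0, !e) ++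
        ((1, !e) :: t))) ++ [(0, e)] = blockWord D := by
      rw [hD, blockWord_cons, blockWord_append, blockWord_replicate_zero, ← hDe, bWord_signedExp]
      simp [List.replicate_succ (n := n)]
    have hcl := isClosedForm_of_concat hcr hword
    refine ⟨e, D, hcl, hword ▸ hrot2, ?_⟩
    obtain ⟨X, hX⟩ := blockWord_eq_concat e hcl.shift.ne_nil
    rw [hcl.shift.lastSign_eq] at hX
    have hz : ∃ Z, blockWord (shift e D) = List.replicate (k + 1) (1, e) ++
        (0, !e) :: (1, !e) :: Z := by
      have e1 : signedExp e (k + 1) + sideExp e + sideExp (!e) - 1 = signedExp e (k + 1) := by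
        cases e <;> simp [sideExp]
      rw [hD, shift, shift_append, shift_replicate_zero, lastSign_replicate, shift, blockWord_cons,
        e1, bWord_signedExp, blockWord_append, blockWord_cons]
      cases n with
      | zero =>
        have h1 : m + sideExp (!e) + sideExp ε' - 1 ≠ 0 ∧
            decide (0 < m + sideExp (!e) + sideExp ε' - 1) = !e := by
          cases e <;> cases ε' <;> simp [sideExp] at hm ⊢ <;> omega
        rw [bWord_of_ne_zero h1.1, h1.2]
        exact ⟨_, by simp [blockWord]; rfl⟩
      | succ n =>
        rw [List.replicate_succ (n := n), blockWord_cons]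
        cases e
        · exact ⟨_, by simp [bWord]; rfl⟩
        · exact ⟨_, by simp [bWord]; rfl⟩
    obtain ⟨Z, hZ⟩ := hz
    refine ⟨[(0, e)] ++ X, by rw [hX]; exact List.isRotated_append, 0, 1, e, k, 0, by simp, ?_⟩
    cases X with
    | nil => rw [hX] at hZ; simp [List.replicate_succ] at hZ
    | cons x X =>
      have hlen : ∃ Z', x :: X = List.replicate (k + 1) (1, e) ++ (0, !e) :: (1, !e) :: Z' := by
        rw [hX] at hZ
        rcases List.eq_nil_or_concat Z with rfl | ⟨Z', z, rfl⟩
        · rw [show List.replicate (k + 1) ((1 : Fin 2), e) ++ [(0, !e), (1, !e)] =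
            (List.replicate (k + 1) (1, e) ++ [(0, !e)]) ++ [(1, !e)] by simp] at hZ
          have := (List.append_inj' hZ rfl).2
          simp at this
        · refine ⟨Z', ?_⟩
          rw [List.concat_eq_append, ← List.cons_append, ← List.cons_append, ← List.append_assoc]
            at hZ
          exact (List.append_inj' hZ rfl).1
      obtain ⟨Z', hZ'⟩ := hlen
      rw [hZ']
      exact ⟨[], Z', by simp⟩
  · -- the turn of `b ^ e a ^ (e (k + 1)) b ^ (-e (n + 1)) a ^ (-e)`; if `k > 0`, then `σ`
    -- puts the new letter `b ^ e` between the last two letters `a ^ e`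
    obtain rfl : i = 1 := by omega
    obtain rfl : j = 0 := by omega
    have hrot2 : L ~r (List.replicate (n + 1) (1, !e) ++ (0, !e) :: (t ++ (1, e) ::
        List.replicate k (0, e))) ++ [(0, e)] := by
      refine hrot.trans ?_
      have := List.isRotated_append (l := ((1 : Fin 2), e) :: List.replicate (k + 1) (0, e))
        (l' := List.replicate (n + 1) (1, !e) ++ (0, !e) :: t)
      simpa [List.replicate_succ' (n := k)] using this
    have hcr := hL.isRotated hrot2
    obtain ⟨D', m, hDe⟩ := exists_blockWord_append_bWord (t ++ [(1, e)])
      (hcr.isReduced.infix ⟨List.replicate (n + 1) (1, !e) ++ [(0, !e)],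
        List.replicate k (0, e) ++ [(0, e)], by simp⟩)
    have hm := ne_zero_and_sign_eq_of_concat hDe
    set D := (signedExp (!e) (n + 1), !e) :: (D' ++ (m, e) :: List.replicate k (0, e)) with hD
    have hword : (List.replicate (n + 1) (1, !e) ++ (0, !e) :: (t ++ (1, e) ::
        List.replicate k (0, e))) ++ [(0, e)] = blockWord D := by
      rw [hD, blockWord_cons, blockWord_append, blockWord_cons, blockWord_replicate_zero,
        bWord_signedExp, ← List.append_assoc (blockWord D'), ← hDe, ← List.replicate_succ,
        List.replicate_succ' (n := k)]
      simp
    have hcl := isClosedForm_of_concat hcr hword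
    refine ⟨e, D, hcl, hword ▸ hrot2, ?_⟩
    have e1 : signedExp (!e) (n + 1) + sideExp e + sideExp (!e) - 1 = signedExp (!e) (n + 1) := by
      cases e <;> simp [sideExp]
    rw [hD, shift, e1, blockWord_cons, bWord_signedExp, shift_append, shift, shift_replicate_zero,
      blockWord_append]
    generalize lastSign (!e) D' = s
    have hz : ∃ Z, blockWord ((m + sideExp s + sideExp e - 1, e) ::
        List.replicate k (if e = true then 1 else -1, e)) = Z ++ [(1, e), (0, e)] := by
      cases k with
      | zero =>
        have h1 : m + sideExp s + sideExp e - 1 ≠ 0 ∧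
            decide (0 < m + sideExp s + sideExp e - 1) = e := by
          cases e <;> cases s <;> simp [sideExp] at hm ⊢ <;> omega
        rw [blockWord_cons, bWord_of_ne_zero' h1.1, h1.2]
        exact ⟨_, by simp [blockWord]; rfl⟩
      | succ k =>
        rw [List.replicate_succ', ← List.cons_append, blockWord_append, blockWord_cons (D := [])]
        refine ⟨blockWord ((m + sideExp s + sideExp e - 1, e) ::
          List.replicate k (if e = true then 1 else -1, e)), ?_⟩
        cases e <;> simp [bWord, show blockWord [] = [] from rfl]
    obtain ⟨Z, hZ⟩ := hz
    dsimp only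
    rw [hZ]
    refine ⟨[(1, e), (0, e)] ++ (List.replicate (n + 1) (1, !e) ++ (0, !e) ::
      (blockWord (shift (!e) D') ++ Z)), ?_, 1, 0, e, 0, n, by simp, ?_⟩
    · have := List.isRotated_append (l := List.replicate (n + 1) ((1 : Fin 2), !e) ++ (0, !e) ::
        (blockWord (shift (!e) D') ++ Z)) (l' := [(1, e), (0, e)])
      simpa using this
    · exact ⟨[], blockWord (shift (!e) D') ++ Z, by simp⟩

/-! ### Stuck words -/

/-- `v` is represented by a word all of whose letters have the sign `q`. -/
def IsSigned (q : Bool) (v : F2) : Prop := ∃ W : List (Fin 2 × Bool), (∀ x ∈ W, x.2 = q) ∧ v = mk W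

theorem IsSigned.mul {q : Bool} {u v : F2} (hu : IsSigned q u) (hv : IsSigned q v) :
    IsSigned q (u * v) := by
  obtain ⟨U, hU, rfl⟩ := hu
  obtain ⟨V, hV, rfl⟩ := hv
  refine ⟨U ++ V, fun x hx => ?_, mul_mk⟩
  rcases List.mem_append.mp hx with h | h
  · exact hU x h
  · exact hV x h

theorem isSigned_one (q : Bool) : IsSigned q 1 := ⟨[], by simp, one_eq_mk⟩

theorem isSigned_mk (q : Bool) (i : Fin 2) : IsSigned q (mk [(i, q)]) := ⟨[(i, q)], by simp, rfl⟩

theorem IsSigned.pow {q : Bool} {v : F2} (h : IsSigned q v) (k : ℕ) : IsSigned q (v ^ k) := by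
  induction k with
  | zero => rw [pow_zero]; exact isSigned_one q
  | succ k ih => rw [pow_succ]; exact ih.mul h

theorem IsSigned.essPositive {q : Bool} {v : F2} (h : IsSigned q v) : EssPositive v := by
  obtain ⟨W, hW, rfl⟩ := h
  exact essPositive_of_coherent fun x hx y hy _ => by rw [hW x hx, hW y hy]

/-- `τ`, or its composition with the conjugation by `a`: the version of `τ` that puts `a ^ q` in
front of `b ^ q`. -/
def leftτ (q : Bool) : MulAut F2 := if q then MulAut.conj a * τ else τ

theorem leftτ_zero (q e : Bool) : leftτ q (mk [(0, e)]) = mk [(0, e)] := by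
  cases q <;> cases e <;> simp [leftτ, mk_zero_true, mk_zero_false, τ_a]

theorem leftτ_one (q : Bool) : leftτ q (mk [(1, q)]) = mk [(0, q)] * mk [(1, q)] := by
  cases q <;> simp [leftτ, mk_zero_true, mk_zero_false, mk_one_true, mk_one_false, τ_b, mul_assoc]

theorem isConj_leftτ (q : Bool) (v : F2) : IsConj (leftτ q v) (τ v) := by
  cases q
  · exact IsConj.refl _
  · exact (isConj_iff.mpr ⟨a, rfl⟩ : IsConj (τ v) _).symm

theorem leftτ_bWord {q : Bool} {n : ℤ} (hq : decide (0 < n) = q) :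
    leftτ q (mk (bWord n)) = (mk [(0, q)] * mk [(1, q)]) ^ n.natAbs := by
  rw [bWord, mk_replicate, map_pow, hq, leftτ_one]

theorem isSigned_leftτ_bWord {q : Bool} {n : ℤ} (hq : decide (0 < n) = q) :
    IsSigned q (leftτ q (mk (bWord n))) := by
  rw [leftτ_bWord hq]
  exact ((isSigned_mk q 0).mul (isSigned_mk q 1)).pow _

theorem isSigned_leftτ_flip_bWord {q : Bool} {n : ℤ} (hn : n ≠ 0) (hq : decide (0 < n) = q) :
    IsSigned q (mk [(0, !q)] * leftτ q (mk (bWord n))) := by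
  obtain ⟨k, hk⟩ := Nat.exists_eq_succ_of_ne_zero (Int.natAbs_ne_zero.mpr hn)
  rw [leftτ_bWord hq, hk, pow_succ', mul_assoc (mk [(0, q)]),
    show (mk [(0, !q)] : F2) = (mk [(0, q)])⁻¹ from mk_flip (0, q), inv_mul_cancel_left]
  exact (isSigned_mk q 1).mul (((isSigned_mk q 0).mul (isSigned_mk q 1)).pow _)

theorem mk_blockWord_cons' (p : ℤ × Bool) (D : List (ℤ × Bool)) :
    (mk (blockWord (p :: D)) : F2) = mk (bWord p.1) * mk [(0, p.2)] * mk (blockWord D) := by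
  rw [mk_blockWord_cons, mk_bWord]

/-- In a stuck word without persistent turns, a letter of the wrong sign `!q` can only occur as an
isolated `a ^ (!q)` between two powers of `b ^ q`. Reading such a word from a letter `a ^ q` whose
run is entered from `b ^ q`, one meets a persistent turn, or `leftτ q` cancels all the wrong
letters, or the word breaks off after such a letter. -/
theorem persistentTurn_or_isSigned_of_isStuck (q : Bool) (D : List (ℤ × Bool))
    (U : List (Fin 2 × Bool)) (k : ℕ) (hred : BlockReduced q D) (hst : IsStuck (q, false) D) :
    HasPersistentTurn (U ++ (1, q) :: (List.replicate (k + 1) (0, q) ++ blockWord D)) ∨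
    (lastSign q D = q ∧ IsSigned q (leftτ q (mk (blockWord D)))) ∨
    ∃ D₀ n, D = D₀ ++ [(n, !q)] ∧ lastSign q D₀ = q ∧ n ≠ 0 ∧ decide (0 < n) = q := by
  induction hN : D.length using Nat.strong_induction_on generalizing D U k with
  | _ N ih =>
  subst hN
  rcases D with _ | ⟨⟨n, ε⟩, D⟩
  · refine .inr (.inl ⟨rfl, ?_⟩)
    rw [show (mk (blockWord []) : F2) = 1 from one_eq_mk.symm, _root_.map_one]
    exact isSigned_one q
  · replace ih := fun E hE U k h1 h2 => ih _ hE E U k h1 h2 rfl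
    simp only [List.length_cons] at ih
    by_cases hn : n = 0
    · subst hn
      obtain rfl : q = ε := hred.1 rfl
      rcases ih D (by omega) U (k + 1) hred.2 hst.2.2 with h | ⟨h1, h2⟩ | ⟨D₀, m, rfl, h1, h2⟩
      · left
        rw [List.replicate_succ'] at h
        simpa [blockWord_cons, bWord_zero] using h
      · refine .inr (.inl ⟨h1, ?_⟩)
        rw [mk_blockWord_cons', map_mul, map_mul, bWord_zero, leftτ_zero]
        rw [show (mk [] : F2) = 1 from one_eq_mk.symm, _root_.map_one]
        exact ((isSigned_one q).mul (isSigned_mk q 0)).mul h2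
      · exact .inr (.inr ⟨(0, q) :: D₀, m, rfl, h1, h2⟩)
    by_cases hε : ε = q
    · subst hε
      have hs : decide (0 < n) = ε := hst.2.1 hn rfl
      have hst' : IsStuck (ε, false) D := by
        have := hst.2.2
        simpa [blockFlag, hn, hs] using this
      rcases ih D (by omega) (U ++ (1, ε) :: (List.replicate (k + 1) (0, ε) ++
        List.replicate (n.natAbs - 1) (1, ε))) 0 hred.2 hst' with
          h | ⟨h1, h2⟩ | ⟨D₀, m, rfl, h1, h2⟩
      · left
        rw [blockWord_cons, bWord_of_ne_zero' hn, hs]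
        simpa using h
      · refine .inr (.inl ⟨h1, ?_⟩)
        rw [mk_blockWord_cons', map_mul, map_mul, leftτ_zero]
        exact ((isSigned_leftτ_bWord hs).mul (isSigned_mk ε 0)).mul h2
      · exact .inr (.inr ⟨(n, ε) :: D₀, m, rfl, h1, h2⟩)
    obtain rfl : ε = !q := Bool.eq_not.mpr hε
    by_cases hs : decide (0 < n) = q
    swap
    · -- `b ^ q a ^ q ⋯ a ^ q b ^ (!q) ⋯ b ^ (!q) a ^ (!q)`
      left
      have hs' : decide (0 < n) = !q := Bool.eq_not.mpr hs
      refine ⟨1, 0, q, k, n.natAbs - 1, by simp, U, blockWord D, ?_⟩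
      rw [blockWord_cons, bWord, hs', Nat.sub_add_cancel (by omega)]
      simp
    rcases D with _ | ⟨⟨m, ε'⟩, D⟩
    · exact .inr (.inr ⟨[], n, rfl, rfl, hn, hs⟩)
    · have hst2 := hst.2.2
      have hfl : blockFlag false (n, !q) = true := by cases q <;> simp_all [blockFlag]
      rw [hfl] at hst2
      have hm : m ≠ 0 := fun h => by simpa using hst2.1 h
      by_cases hms : decide (0 < m) = q
      swap
      · -- `a ^ q b ^ q ⋯ b ^ q a ^ (!q) b ^ (!q)`
        left
        have hms' : decide (0 < m) = !q := Bool.eq_not.mpr hms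
        refine ⟨0, 1, q, n.natAbs - 1, 0, by simp, U ++ (1, q) :: List.replicate k (0, q),
          List.replicate (m.natAbs - 1) (1, !q) ++ (0, ε') :: blockWord D, ?_⟩
        rw [blockWord_cons, blockWord_cons, bWord_of_ne_zero hm, hms', bWord, hs,
          Nat.sub_add_cancel (by omega), List.replicate_succ' (n := k)]
        simp
      have hε' : ε' = q := by
        by_contra h
        obtain rfl : ε' = !q := Bool.eq_not.mpr h
        have := hst2.2.1 hm rfl
        rw [hms] at this
        simp at this
      subst hε'
      have hst' : IsStuck (ε', false) D := by
        have := hst2.2.2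
        simpa [blockFlag, hm, hms] using this
      rcases ih D (by simp only [List.length_cons]; omega)
        (U ++ (1, ε') :: (List.replicate (k + 1) (0, ε') ++
          (bWord n ++ (0, !ε') :: List.replicate (m.natAbs - 1) (1, ε')))) 0 hred.2.2 hst' with
          h | ⟨h1, h2⟩ |
          ⟨D₀, l, rfl, h1, h2⟩
      · left
        rw [blockWord_cons, blockWord_cons, bWord_of_ne_zero' hm, hms]
        simpa using h
      · refine .inr (.inl ⟨h1, ?_⟩)
        rw [mk_blockWord_cons', mk_blockWord_cons', map_mul, map_mul, map_mul, map_mul, leftτ_zero,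
          leftτ_zero]
        have := ((isSigned_leftτ_bWord hs).mul ((isSigned_leftτ_flip_bWord hm hms).mul
          (isSigned_mk ε' 0))).mul h2
        simpa only [mul_assoc] using this
      · exact .inr (.inr ⟨(n, !ε') :: (m, ε') :: D₀, l, rfl, h1, h2⟩)

theorem lastSign_concat (ε : Bool) (D : List (ℤ × Bool)) (p : ℤ × Bool) :
    lastSign ε (D ++ [p]) = p.2 := by
  rw [lastSign_append]; rfl

/-- A stuck cyclic word that is cut open behind an isolated wrong letter `a ^ (!q)` and the
following `b ^ m a ^ q`: if there is no persistent turn, then `leftτ q` cancels all wrong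
letters. -/
theorem isPersistent_or_essPositive_of_flipped_letter {q : Bool} {D : List (ℤ × Bool)} {n m : ℤ}
    (hred : BlockReduced q D) (hst : IsStuck (q, false) D) (hl : lastSign q D = q)
    (hnq : decide (0 < n) = q) (hm : m ≠ 0) (hmq : decide (0 < m) = q) :
    IsPersistent (blockWord (D ++ [(n, !q), (m, q)])) ∨
      EssPositive (τ (mk (blockWord (D ++ [(n, !q), (m, q)])))) := by
  have hnil : blockWord [] = [] := rfl
  rcases persistentTurn_or_isSigned_of_isStuck q D (List.replicate (m.natAbs - 1) (1, q)) 0 hred hst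
    with h | ⟨-, h⟩ | ⟨D₀, l, rfl, -⟩
  · left
    refine ⟨(bWord m ++ [(0, q)]) ++ (blockWord D ++ (bWord n ++ [(0, !q)])), ?_, ?_⟩
    · have := List.isRotated_append (l := blockWord D ++ (bWord n ++ [(0, !q)]))
        (l' := bWord m ++ [(0, q)])
      simpa [blockWord_append, blockWord_cons, hnil] using this
    · refine h.of_infix ⟨[], bWord n ++ [(0, !q)], ?_⟩
      rw [bWord_of_ne_zero' hm, hmq]
      simp
  · right
    refine EssPositive.of_isConj ?_ (isConj_leftτ q _)
    apply IsSigned.essPositive (q := q)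
    rw [blockWord_append, ← mul_mk, mk_blockWord_cons', mk_blockWord_cons', hnil, map_mul, map_mul,
      map_mul, map_mul, map_mul, leftτ_zero, leftτ_zero,
      show (mk [] : F2) = 1 from one_eq_mk.symm, _root_.map_one]
    have := h.mul ((isSigned_leftτ_bWord hnq).mul ((isSigned_leftτ_flip_bWord hm hmq).mul
      (isSigned_mk q 0)))
    simpa only [mul_assoc, mul_one] using this
  · rw [lastSign_concat] at hl
    simp at hl

theorem all_eq_or_exists_sign_change (ε : Bool) (D : List (ℤ × Bool)) :
    (∀ p ∈ D, p.2 = ε) ∨ ∃ D₁ n D₂, D = D₁ ++ (n, !ε) :: D₂ ∧ lastSign ε D₁ = ε := by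
  induction D with
  | nil => simp
  | cons p D ih =>
    obtain ⟨n, e⟩ := p
    by_cases h : e = ε
    · subst h
      rcases ih with h | ⟨D₁, m, D₂, rfl, h⟩
      · exact .inl (by simpa using h)
      · exact .inr ⟨(n, e) :: D₁, m, D₂, rfl, h⟩
    · obtain rfl : e = !ε := Bool.eq_not.mpr h
      exact .inr ⟨[], n, D, rfl, rfl⟩

theorem sign_eq_of_isStuck {ε f : Bool} {D : List (ℤ × Bool)} (hst : IsStuck (ε, f) D)
    (h : ∀ p ∈ D, p.2 = ε) : ∀ x ∈ blockWord D, x.2 = ε := by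
  induction D generalizing f with
  | nil => simp [blockWord]
  | cons p D ih =>
    intro x hx
    have hp : p.2 = ε := h p (by simp)
    rw [blockWord_cons, List.mem_append, List.mem_cons] at hx
    rcases hx with hx | rfl | hx
    · rw [bWord, List.mem_replicate] at hx
      rw [hx.2]
      exact hst.2.1 (by simpa using hx.1) hp.symm
    · exact hp
    · have := hst.2.2
      rw [hp] at this
      exact ih this (fun p hp => h p (by simp [hp])) x hx

/-- If `σ` does not lower the cost of a cyclic word, then the word contains a persistent turn, or it
is essentially positive, or `τ` makes it essentially positive. -/
theorem IsClosedForm.trichotomy_of_isStuck {ε f : Bool} {D : List (ℤ × Bool)}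
    (h : IsClosedForm ε D) (hf : blockEnd (ε, f) D = (ε, f)) (hst : IsStuck (ε, f) D) :
    IsPersistent (blockWord D) ∨ EssPositive (FreeGroup.mk (blockWord D)) ∨
      EssPositive (τ (FreeGroup.mk (blockWord D))) := by
  -- if the sign of `a` never changes, then a stuck word has no wrong letter at all
  rcases all_eq_or_exists_sign_change ε D with hall | ⟨D₁, n, D₂, hD, hD₁⟩
  · right; left
    have hs := sign_eq_of_isStuck hst hall
    exact essPositive_of_coherent fun x hx y hy _ => by rw [hs x hx, hs y hy]
  have hred := h.reduced
  have hls := h.lastSign_eq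
  rw [hD] at hred hls hst hf
  rw [blockReduced_append, hD₁] at hred
  rw [lastSign_append, hD₁, lastSign_cons] at hls
  have hn : n ≠ 0 := fun h0 => by simpa using hred.2.1 h0
  rw [isStuck_append] at hst
  rw [blockEnd_append] at hf
  have hs₁ : blockEnd (ε, f) D₁ = (ε, (blockEnd (ε, f) D₁).2) :=
    Prod.ext ((blockEnd_fst _ _).trans hD₁) rfl
  rw [hs₁] at hf hst
  generalize (blockEnd (ε, f) D₁).2 = f₁ at hf hst
  have hflag : blockFlag f₁ (n, !ε) = (decide (0 < n) != !ε) := by simp [blockFlag, hn]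
  have hf₂ : blockEnd (!ε, decide (0 < n) != !ε) D₂ = (ε, f) := by rw [← hflag]; exact hf
  have hst₂ := hst.2.2.2
  dsimp only at hst₂
  rw [hflag] at hst₂
  -- `E` is the cyclic word without the block `(n, !ε)`, read from the end of that block
  obtain ⟨E, hE⟩ : ∃ E, E = D₂ ++ D₁ := ⟨_, rfl⟩
  have hEst : IsStuck (!ε, decide (0 < n) != !ε) E := by
    rw [hE, isStuck_append, hf₂]; exact ⟨hst₂, hst.1⟩
  have hEred : BlockReduced (!ε) E := by
    rw [hE, blockReduced_append, hls]; exact ⟨hred.2.2, hred.1⟩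
  have hEl : lastSign (!ε) E = ε := by rw [hE, lastSign_append, hls, hD₁]
  have hrot : blockWord D ~r blockWord (E ++ [(n, !ε)]) := by
    have := List.isRotated_append (l := blockWord (D₁ ++ [(n, !ε)])) (l' := blockWord D₂)
    simpa [hD, hE, blockWord_append, blockWord_cons, show blockWord [] = [] from rfl] using this
  have transfer : ∀ E', blockWord (E ++ [(n, !ε)]) ~r blockWord E' →
      IsPersistent (blockWord E') ∨ EssPositive (τ (FreeGroup.mk (blockWord E'))) →
      IsPersistent (blockWord D) ∨ EssPositive (FreeGroup.mk (blockWord D)) ∨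
        EssPositive (τ (FreeGroup.mk (blockWord D))) := by
    intro E' hE' hor
    have hr := (hrot.trans hE').symm
    rcases hor with hp | hp
    · exact .inl (hp.isRotated hr)
    · exact .inr (.inr (hp.of_isConj (τ.toMonoidHom.map_isConj (isConj_mk_of_isRotated hr))))
  by_cases hns : decide (0 < n) = !ε
  · -- `b ^ n a ^ (!ε)` has no turn inside; with `!ε` as the right sign, the last letter `a ^ ε` of
    -- `E` must be the isolated wrong one
    have e0 : (decide (0 < n) != !ε) = false := by rw [hns]; simp
    rw [e0] at hEst
    rcases persistentTurn_or_isSigned_of_isStuck (!ε) E (List.replicate (n.natAbs - 1) (1, !ε)) 0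
      hEred hEst with hp | ⟨hl, -⟩ | ⟨D₀, m, rfl, hl, hm, hms⟩
    · refine transfer _ (List.IsRotated.refl _)
        (.inl ⟨(bWord n ++ [(0, !ε)]) ++ blockWord E, ?_, ?_⟩)
      · have := List.isRotated_append (l := blockWord E) (l' := bWord n ++ [(0, !ε)])
        simpa [blockWord_append, blockWord_cons, show blockWord [] = [] from rfl] using this
      · refine hp.of_infix ⟨[], [], ?_⟩
        rw [bWord_of_ne_zero' hn, hns]
        simp
    · rw [hEl] at hl; simp at hl
    · rw [isStuck_append] at hEst
      rw [blockReduced_append] at hEred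
      refine transfer (D₀ ++ [(m, !!ε), (n, !ε)])
        (by rw [List.append_assoc]; exact List.IsRotated.refl _) ?_
      exact isPersistent_or_essPositive_of_flipped_letter hEred.1 hEst.1 hl hms hn hns
  · -- with `ε` as the right sign, the letter `a ^ (!ε)` after `b ^ n` is the isolated wrong one
    have hns' : decide (0 < n) = ε := by simpa using Bool.eq_not.mpr hns
    have e0 : (decide (0 < n) != !ε) = true := by rw [hns']; simp
    rw [e0] at hEst
    have hEne : E ≠ [] := by rintro rfl; simp [lastSign] at hEl
    obtain ⟨M, hM⟩ := blockWord_eq_concat (!ε) hEne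
    rw [hEl] at hM
    obtain ⟨⟨m, e⟩, D₄, rfl⟩ := List.exists_cons_of_ne_nil hEne
    have hm : m ≠ 0 := fun h0 => by simpa using hEst.1 h0
    by_cases hms : decide (0 < m) = !ε
    · obtain ⟨M', rfl⟩ : ∃ M', M = (1, !ε) :: M' := by
        rw [blockWord_cons, bWord_of_ne_zero hm, hms] at hM
        cases M with
        | nil => simp at hM
        | cons x M =>
          simp only [List.cons_append, List.cons.injEq] at hM
          exact ⟨M, by rw [← hM.1]⟩
      refine transfer _ (List.IsRotated.refl _)
        (.inl ⟨((0, ε) :: (bWord n ++ [(0, !ε)])) ++ (1, !ε) :: M', ?_, ?_⟩)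
      · have := List.isRotated_append (l := (1, !ε) :: M') (l' := (0, ε) :: (bWord n ++ [(0, !ε)]))
        rw [blockWord_append, hM]
        simpa [blockWord_append, blockWord_cons, show blockWord [] = [] from rfl] using this
      · refine ⟨0, 1, ε, n.natAbs - 1, 0, by simp, [], M', ?_⟩
        rw [bWord, hns', Nat.sub_add_cancel (by omega)]
        simp
    · have hms' : decide (0 < m) = ε := by simpa using Bool.eq_not.mpr hms
      have he : e = ε := by
        by_contra hne
        obtain rfl : e = !ε := Bool.eq_not.mpr hne
        exact hms (hEst.2.1 hm rfl)
      subst he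
      have hst₄ : IsStuck (e, false) D₄ := by
        have := hEst.2.2
        simpa [blockFlag, hm, hms'] using this
      refine transfer (D₄ ++ [(n, !e), (m, e)]) ?_
        (isPersistent_or_essPositive_of_flipped_letter hEred.2 hst₄ hEl hns' hm hms')
      have := List.isRotated_append (l := blockWord [(m, e)]) (l' := blockWord (D₄ ++ [(n, !e)]))
      simpa [blockWord_append, blockWord_cons, show blockWord [] = [] from rfl] using this

/-! ### Shortening chains -/

/-- One step with `σ`: it does not raise the cost of a cyclic word and preserves persistent turns;
if it keeps the cost, the word contains a persistent turn or is at most one `τ` away from being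
essentially positive. -/
theorem σ_step {L : List (Fin 2 × Bool)} {r : ℕ} (hL : IsCyclicallyReduced L) (hr : HasCost L r) :
    Coherent L ∨ ∃ L', IsCyclicallyReduced L' ∧ IsConj (σ (mk L)) (mk L') ∧
      (IsPersistent L → IsPersistent L') ∧ ∃ r', HasCost L' r' ∧ r' ≤ r ∧
      (r' = r → IsPersistent L ∨ EssPositive (mk L) ∨ EssPositive (τ (mk L))) := by
  by_cases hc : Coherent L
  · exact .inl hc
  right
  have main : ∀ ε D, IsClosedForm ε D → L ~r blockWord D →
      (IsPersistent L → IsPersistent (blockWord (shift ε D))) →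
      ∃ L', IsCyclicallyReduced L' ∧ IsConj (σ (mk L)) (mk L') ∧
      (IsPersistent L → IsPersistent L') ∧ ∃ r', HasCost L' r' ∧ r' ≤ r ∧
      (r' = r → IsPersistent L ∨ EssPositive (mk L) ∨ EssPositive (τ (mk L))) := by
    intro ε D hD hrot hp
    have hconj := isConj_mk_of_isRotated hrot
    obtain ⟨f, hf, rfl⟩ := (hD.hasCost_iff r).mp (hr.isRotated hrot)
    obtain ⟨r', -, hr'⟩ := exists_hasCost (blockWord (shift ε D))
    obtain ⟨f', -, hf'⟩ := (hD.shift.hasCost_iff r').mp hr'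
    obtain ⟨h1, h2⟩ := blockCost_shift_le hD.reduced f f'
    refine ⟨_, hD.shift.isCyclicallyReduced,
      (σ.toMonoidHom.map_isConj hconj).trans hD.isConj_σ, hp, r', hr', hf' ▸ h1, fun heq => ?_⟩
    rcases hD.trichotomy_of_isStuck hf (h2 (hf'.trans heq)) with h | h | h
    · exact .inl (h.isRotated hrot.symm)
    · exact .inr (.inl (h.of_isConj hconj.symm))
    · exact .inr (.inr (h.of_isConj (τ.toMonoidHom.map_isConj hconj.symm)))
  by_cases hp : IsPersistent L
  · obtain ⟨ε, D, hD, hrot, hp'⟩ := hp.exists_isClosedForm hL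
    exact main ε D hD hrot fun _ => hp'
  · obtain ⟨ε, D, hD, hrot⟩ := (coherent_or_exists_isClosedForm hL).resolve_left hc
    exact main ε D hD hrot fun h => absurd h hp

/-- The letter with the generators `a`, `b` exchanged. -/
def swapLetter (x : Fin 2 × Bool) : Fin 2 × Bool := (Equiv.swap 0 1 x.1, x.2)

theorem swapLetter_swapLetter (x : Fin 2 × Bool) : swapLetter (swapLetter x) = x := by
  simp [swapLetter]

theorem map_swapLetter_map_swapLetter (L : List (Fin 2 × Bool)) :
    (L.map swapLetter).map swapLetter = L := by
  rw [List.map_map, show swapLetter ∘ swapLetter = id from funext swapLetter_swapLetter,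
    List.map_id]

theorem swapAut_mk (L : List (Fin 2 × Bool)) : swapAut (mk L) = mk (L.map swapLetter) := by
  simp only [swapAut, freeGroupCongr_apply, map.mk]; rfl

theorem isCyclicallyReduced_map_swapLetter {L : List (Fin 2 × Bool)} (hL : IsCyclicallyReduced L) :
    IsCyclicallyReduced (L.map swapLetter) :=
  isCyclicallyReduced_map (Function.LeftInverse.injective swapLetter_swapLetter) (fun _ => rfl) hL

theorem run_map_swapLetter (s : (Fin 2 × Bool) × Bool) (L : List (Fin 2 × Bool)) :
    runEnd (swapLetter s.1, s.2) (L.map swapLetter) =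
      (swapLetter (runEnd s L).1, (runEnd s L).2) ∧
    runCost (swapLetter s.1, s.2) (L.map swapLetter) = runCost s L := by
  induction L generalizing s with
  | nil => exact ⟨rfl, rfl⟩
  | cons y L ih =>
    have : stepFlag (swapLetter s.1, s.2) (swapLetter y) = stepFlag s y := by
      simp [stepFlag, swapLetter]
    rw [List.map_cons, runEnd_cons, runCost, this, runEnd_cons, runCost]
    exact ⟨(ih (y, stepFlag s y)).1, by rw [(ih (y, stepFlag s y)).2]⟩

theorem HasCost.map_swapLetter {L : List (Fin 2 × Bool)} {r : ℕ} (h : HasCost L r) :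
    HasCost (L.map swapLetter) r := by
  obtain ⟨s, h1, h2⟩ := h
  refine ⟨(swapLetter s.1, s.2), ?_, ?_⟩
  · rw [(run_map_swapLetter s L).1, h1]
  · rw [(run_map_swapLetter s L).2, h2]

theorem IsPersistent.map_swapLetter {L : List (Fin 2 × Bool)} (h : IsPersistent L) :
    IsPersistent (L.map swapLetter) := by
  obtain ⟨M, hM, i, j, e, k, n, hij, hinf⟩ := h
  refine ⟨M.map swapLetter, hM.map _, Equiv.swap 0 1 i, Equiv.swap 0 1 j, e, k, n,
    by simpa using hij, ?_⟩
  have := hinf.map swapLetter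
  simpa [swapLetter] using this

theorem EssPositive.of_swapAut {v : F2} (h : EssPositive (swapAut v)) : EssPositive v :=
  h.of_isW1 (isW1_of_mem_signedPerms swapAut_mem)

theorem swapAut_swapAut (v : F2) : swapAut (swapAut v) = v := by
  rw [← MulAut.mul_apply, swapAut_mul_self]; rfl

theorem chainGen_swapAut (x : Bool) (v : F2) :
    chainGen true x (swapAut v) = swapAut (chainGen true (!x) v) := by
  rw [← MulAut.mul_apply, chainGen_mul_swapAut]; rfl

/-- One step with `σ` or `τ`: `σ_step`, and its image under the exchange of `a` and `b`. -/
theorem chainGen_step (x : Bool) {L : List (Fin 2 × Bool)} {r : ℕ} (hL : IsCyclicallyReduced L)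
    (hr : HasCost L r) :
    Coherent L ∨ ∃ L', IsCyclicallyReduced L' ∧ IsConj (chainGen true x (mk L)) (mk L') ∧
      (IsPersistent L → IsPersistent L') ∧ ∃ r', HasCost L' r' ∧ r' ≤ r ∧
      (r' = r → IsPersistent L ∨ EssPositive (mk L) ∨
        EssPositive (chainGen true (!x) (mk L))) := by
  cases x
  · rcases σ_step (isCyclicallyReduced_map_swapLetter hL) hr.map_swapLetter with
      h | ⟨L', h1, h2, h3, r', h4, h5, h6⟩
    · left
      intro x hx y hy hxy
      exact h (swapLetter x) (List.mem_map_of_mem hx) (swapLetter y) (List.mem_map_of_mem hy)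
        (by simp [swapLetter, hxy])
    · refine .inr ⟨L'.map swapLetter, isCyclicallyReduced_map_swapLetter h1, ?_,
        fun h => (h3 h.map_swapLetter).map_swapLetter, r', h4.map_swapLetter, h5, fun heq => ?_⟩
      · have := swapAut.toMonoidHom.map_isConj h2
        rw [← swapAut_mk] at this
        have e : swapAut (σ (swapAut (mk L))) = chainGen true false (mk L) := by
          rw [show σ = chainGen true true from rfl, chainGen_swapAut, swapAut_swapAut]; rfl
        rw [← e, ← swapAut_mk]
        exact this
      · rcases h6 heq with h | h | h
        · left
          simpa only [map_swapLetter_map_swapLetter] using h.map_swapLetter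
        · rw [← swapAut_mk] at h
          exact .inr (.inl h.of_swapAut)
        · rw [← swapAut_mk, show τ = chainGen true false from rfl, chainGen_swapAut] at h
          exact .inr (.inr h.of_swapAut)
  · exact σ_step hL hr

theorem chainWord_concat_apply (e x : Bool) (w : List Bool) (v : F2) :
    chainWord e (w ++ [x]) v = chainWord e w (chainGen e x v) := by
  simp [chainWord]

/-- A chain of type (C1) cannot make a cyclic word with a persistent turn essentially positive. -/
theorem IsPersistent.not_essPositive (w : List Bool) {L : List (Fin 2 × Bool)}
    (hL : IsCyclicallyReduced L) (h : IsPersistent L) :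
    ¬ EssPositive (chainWord true w (mk L)) := by
  induction w using List.reverseRecOn generalizing L with
  | nil =>
    intro hp
    exact h.not_coherent ((essPositive_mk_iff hL).mp hp)
  | append_singleton w x ih =>
    intro hp
    obtain ⟨r, -, hr⟩ := exists_hasCost L
    obtain ⟨L', h1, h2, h3, -⟩ := (chainGen_step x hL hr).resolve_left h.not_coherent
    rw [chainWord_concat_apply] at hp
    exact ih h1 (h3 h) (hp.of_isConj ((chainWord true w).toMonoidHom.map_isConj h2))

/-- If a chain of type (C1) makes a cyclic word essentially positive, then so does a chain whose
length exceeds the cost of the word by at most one. -/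
theorem exists_short_chainWord (w : List Bool) {L : List (Fin 2 × Bool)} {r : ℕ}
    (hL : IsCyclicallyReduced L) (hr : HasCost L r) (h : EssPositive (chainWord true w (mk L))) :
    ∃ w', w'.length ≤ r + 1 ∧ EssPositive (chainWord true w' (mk L)) := by
  induction w using List.reverseRecOn generalizing L r with
  | nil => exact ⟨[], by simp, h⟩
  | append_singleton w x ih =>
    rcases chainGen_step x hL hr with hc | ⟨L', h1, h2, h3, r', h4, h5, h6⟩
    · exact ⟨[], by simp, essPositive_of_coherent hc⟩
    · by_cases heq : r' = r
      · rcases h6 heq with hp | hp | hp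
        · exact absurd h (hp.not_essPositive _ hL)
        · exact ⟨[], by simp, hp⟩
        · exact ⟨[!x], by simp, by simpa [chainWord] using hp⟩
      · rw [chainWord_concat_apply] at h
        obtain ⟨w', hw', hp⟩ := ih h1 h4
          (h.of_isConj ((chainWord true w).toMonoidHom.map_isConj h2))
        refine ⟨w' ++ [x], by simp; omega, ?_⟩
        rw [chainWord_concat_apply]
        exact hp.of_isConj ((chainWord true w').toMonoidHom.map_isConj h2.symm)

/-! ### Chains of type (C2) -/

/-- Chains of type (C2) are conjugate to chains of type (C1) by `a ↦ a, b ↦ b⁻¹`, up to inner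
automorphisms. -/
theorem chainWord_true_mul_signAut (w : List Bool) : ∃ c,
    chainWord true w * signAut ![true, false] =
      MulAut.conj c * signAut ![true, false] * chainWord false w := by
  induction w with
  | nil => exact ⟨1, by simp [chainWord]⟩
  | cons x w ih =>
    obtain ⟨c, hc⟩ := ih
    obtain ⟨d, hd⟩ := chainGen_mul_signAut true x ![true, false]
    refine ⟨chainGen true x c * d, ?_⟩
    rw [chainWord_cons, chainWord_cons, mul_assoc, hc, ← mul_assoc, ← mul_assoc, conj_mul_comm,
      mul_assoc (MulAut.conj _), hd, _root_.map_mul]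
    simp [mul_assoc]

theorem EssPositive.signAut {v : F2} (h : EssPositive v) (s : Fin 2 → Bool) :
    EssPositive (signAut s v) := by
  apply EssPositive.of_isW1 (isW1_signAut s)
  rwa [← MulAut.mul_apply, signAut_mul_self]

theorem essPositive_chainWord_true_signAut (w : List Bool) (v : F2) :
    EssPositive (chainWord true w (F2.signAut ![true, false] v)) ↔
      EssPositive (chainWord false w v) := by
  obtain ⟨c, hc⟩ := chainWord_true_mul_signAut w
  have e : chainWord true w (F2.signAut ![true, false] v) =
      MulAut.conj c (F2.signAut ![true, false] (chainWord false w v)) := by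
    rw [← MulAut.mul_apply, hc]; rfl
  have hconj : IsConj (F2.signAut ![true, false] (chainWord false w v))
      (chainWord true w (F2.signAut ![true, false] v)) := by
    rw [e]; exact isConj_iff.mpr ⟨c, rfl⟩
  exact ⟨fun h => (h.of_isConj hconj.symm).of_isW1 (isW1_signAut _),
    fun h => (h.signAut _).of_isConj hconj⟩

/-- The bound for chains of either type. -/
theorem exists_short_chainWord' (e : Bool) (w : List Bool) {L : List (Fin 2 × Bool)}
    (hL : IsCyclicallyReduced L) (h : EssPositive (chainWord e w (mk L))) :
    ∃ w', w'.length ≤ L.length + 1 ∧ EssPositive (chainWord e w' (mk L)) := by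
  have main : ∀ M : List (Fin 2 × Bool), IsCyclicallyReduced M →
      EssPositive (chainWord true w (mk M)) →
      ∃ w', w'.length ≤ M.length + 1 ∧ EssPositive (chainWord true w' (mk M)) := by
    intro M hM hp
    obtain ⟨r, hr, hc⟩ := exists_hasCost M
    obtain ⟨w', hw', hp'⟩ := exists_short_chainWord w hM hc hp
    exact ⟨w', by omega, hp'⟩
  cases e
  · rw [← essPositive_chainWord_true_signAut, signAut_mk] at h
    obtain ⟨w', hw', hp'⟩ := main _ (isCyclicallyReduced_map (fun x y hxy => by
      rw [Prod.mk.injEq] at hxy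
      refine Prod.ext hxy.1 ?_
      have := hxy.2
      rw [hxy.1] at this
      revert this
      cases x.2 <;> cases y.2 <;> cases (![true, false] : Fin 2 → Bool) y.1 <;> simp)
      (fun x => by
        refine Prod.ext rfl ?_
        dsimp only
        cases x.2 <;> cases (![true, false] : Fin 2 → Bool) x.1 <;> rfl) hL) h
    refine ⟨w', by simpa using hw', ?_⟩
    rwa [← essPositive_chainWord_true_signAut, signAut_mk]
  · exact main L hL h

theorem essPositive_of_isPositive_map {u : F2} {φ : MulAut F2}
    (h : (cyclicWord (φ u)).IsPositive) : ∃ e w, EssPositive (chainWord e w u) := by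
  obtain ⟨c, β, hβ, e, w, rfl⟩ := isChainLike φ
  refine ⟨e, w, EssPositive.of_isW1 (isW1_of_mem_signedPerms hβ) ?_⟩
  have h1 : EssPositive ((MulAut.conj c * β * chainWord e w) u) := ⟨1, IsW1.one, h⟩
  exact h1.of_isConj (isConj_iff.mpr ⟨c, rfl⟩ : IsConj (β (chainWord e w u)) _).symm

/-- A positive cyclic word in the orbit of `u` is reached by a chain of length at most `‖u‖ + 1`. -/
theorem exists_short_of_isPositive_map {u : F2} {φ : MulAut F2}
    (h : (cyclicWord (φ u)).IsPositive) :
    ∃ e w, w.length ≤ cyclicLength u + 1 ∧ EssPositive (chainWord e w u) := by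
  obtain ⟨e, w, hw⟩ := essPositive_of_isPositive_map h
  have hu := isConj_mk_reduceCyclically u
  obtain ⟨w', h1, h2⟩ := exists_short_chainWord' e w
    (reduceCyclically.isCyclicallyReduced isReduced_toWord)
    (hw.of_isConj ((chainWord e w).toMonoidHom.map_isConj hu.symm))
  exact ⟨e, w', h1, h2.of_isConj ((chainWord e w').toMonoidHom.map_isConj hu)⟩

theorem isPotentiallyPositive_of_essPositive {u : F2} {φ : MulAut F2} (h : EssPositive (φ u)) :
    IsPotentiallyPositive u := by
  obtain ⟨β, -, hp⟩ := h
  obtain ⟨c, hc⟩ := (cyclicWord_isPositive_iff _).mp hp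
  exact ⟨MulAut.conj c * β * φ, hc⟩

theorem IsPotentiallyPositive.exists_isPositive_map {u : F2} (h : IsPotentiallyPositive u) :
    ∃ φ : MulAut F2, (cyclicWord (φ u)).IsPositive := by
  obtain ⟨φ, hφ⟩ := h
  exact ⟨φ, (cyclicWord_isPositive_iff _).mpr ⟨1, by simpa using hφ⟩⟩

/-! ### The set `Ω u` -/

theorem chainWord_append (e : Bool) (v w : List Bool) :
    chainWord e (v ++ w) = chainWord e v * chainWord e w := by simp [chainWord]

theorem chainWord_replicate (e x : Bool) (k : ℕ) :
    chainWord e (List.replicate k x) = chainGen e x ^ k := by simp [chainWord]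

theorem exists_chainWord_eq (l : List (ℕ × ℕ)) : ∃ w : List Bool, w.length = chainLength l ∧
    chainC1 l = chainWord true w ∧ chainC2 l = chainWord false w := by
  refine ⟨l.flatMap fun p => List.replicate p.1 false ++ List.replicate p.2 true, ?_, ?_, ?_⟩
  · simp [chainLength, List.length_flatMap]
  · induction l with
    | nil => rfl
    | cons p l ih =>
      rw [List.flatMap_cons, chainWord_append, chainWord_append, chainWord_replicate,
        chainWord_replicate, ← ih]
      simp [chainC1, chainGen]
  · induction l with
    | nil => rfl
    | cons p l ih =>
      rw [List.flatMap_cons, chainWord_append, chainWord_append, chainWord_replicate,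
        chainWord_replicate, ← ih]
      simp [chainC2, chainGen]

theorem chainWord_mem_Ω {u : F2} {e : Bool} {w : List Bool}
    (hw : w.length ≤ 2 * cyclicLength u + 3) : chainWord e w ∈ Ω u := by
  refine ⟨w.map fun x => if x then (0, 1) else (1, 0), ?_, ?_⟩
  · have : chainLength (w.map fun x => if x then (0, 1) else (1, 0)) = w.length := by
      induction w with
      | nil => rfl
      | cons x w ih =>
        have := ih (by simp at hw; omega)
        simp only [chainLength, List.map_cons, List.sum_cons] at this ⊢
        rw [this]
        cases x <;> simp <;> omega
    omega
  · cases e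
    · right
      rw [chainWord, chainC2, List.map_map]
      congr 2
      ext1 x
      cases x <;> simp [chainGen]
    · left
      rw [chainWord, chainC1, List.map_map]
      congr 2
      ext1 x
      cases x <;> simp [chainGen]

theorem finite_Ω (u : F2) : (Ω u).Finite := by
  have h := (List.finite_length_le Bool (2 * cyclicLength u + 3))
  refine ((h.image (chainWord true)).union (h.image (chainWord false))).subset ?_
  rintro ψ ⟨l, hl, hψ⟩
  obtain ⟨w, hw, h1, h2⟩ := exists_chainWord_eq l
  rcases hψ with rfl | rfl
  · exact .inl ⟨w, by rw [Set.mem_ofPred_eq]; omega, h1.symm⟩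
  · exact .inr ⟨w, by rw [Set.mem_ofPred_eq]; omega, h2.symm⟩

theorem exists_mem_Ω_of_isPositive_map {u : F2} {φ : MulAut F2}
    (h : (cyclicWord (φ u)).IsPositive) :
    ∃ ψ ∈ Ω u, ∃ β : MulAut F2, IsW1 β ∧ (cyclicWord (β (ψ u))).IsPositive := by
  obtain ⟨e, w, hw, hp⟩ := exists_short_of_isPositive_map h
  exact ⟨chainWord e w, chainWord_mem_Ω (by omega), hp⟩

/-! ### The decision algorithm -/

/-- The substitution of letters by which `chainGen e x` acts on words. -/
def substLetter (e x : Bool) (y : Fin 2 × Bool) : List (Fin 2 × Bool) :=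
  if (y.1 = 0) = x then
    if y.2 then [y, (1 - y.1, e)] else [(1 - y.1, !e), y]
  else [y]

theorem chainGen_mk (e x : Bool) (w : List (Fin 2 × Bool)) :
    chainGen e x (mk w) = mk (w.flatMap (substLetter e x)) := by
  induction w with
  | nil => exact _root_.map_one _
  | cons y w ih =>
    rw [← List.singleton_append, ← mul_mk, map_mul, ih, List.flatMap_append, ← mul_mk]
    congr 1
    obtain ⟨i, s⟩ := y
    cases e <;> cases x <;> cases s <;> fin_cases i <;>
      simp [chainGen, substLetter, mk_zero_true, mk_zero_false, mk_one_true, mk_one_false,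
        σ_a, σ_b, τ_a, τ_b, σ_symm_a, σ_symm_b, τ_symm_a, τ_symm_b] <;> rfl

/-- The words in the list `S`, and their images under the letters of the chains of type `e`. -/
def expand (e : Bool) (S : List (List (Fin 2 × Bool))) : List (List (Fin 2 × Bool)) :=
  S.flatMap fun w => [w, w.flatMap (substLetter e true), w.flatMap (substLetter e false)]

theorem exists_chainWord_of_mem_expand (e : Bool) (N : ℕ) (w : List (Fin 2 × Bool)) :
    ∀ z ∈ (expand e)^[N] [w], ∃ v, mk z = chainWord e v (mk w) := by
  induction N with
  | zero =>
    intro z hz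
    obtain rfl : z = w := by simpa using hz
    exact ⟨[], by simp [chainWord]⟩
  | succ N ih =>
    intro z hz
    rw [Function.iterate_succ_apply', expand, List.mem_flatMap] at hz
    obtain ⟨y, hy, hz⟩ := hz
    obtain ⟨v, hv⟩ := ih y hy
    simp only [List.mem_cons, List.not_mem_nil, or_false] at hz
    rcases hz with rfl | rfl | rfl
    · exact ⟨v, hv⟩
    · exact ⟨true :: v, by rw [← chainGen_mk, hv, chainWord_cons]; rfl⟩
    · exact ⟨false :: v, by rw [← chainGen_mk, hv, chainWord_cons]; rfl⟩

theorem exists_mem_expand (e : Bool) (N : ℕ) (w : List (Fin 2 × Bool)) :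
    ∀ v : List Bool, v.length ≤ N → ∃ z ∈ (expand e)^[N] [w], mk z = chainWord e v (mk w) := by
  induction N with
  | zero =>
    intro v hv
    obtain rfl : v = [] := List.length_eq_zero_iff.mp (by omega)
    exact ⟨w, by simp, by simp [chainWord]⟩
  | succ N ih =>
    intro v hv
    simp only [Function.iterate_succ_apply', expand, List.mem_flatMap]
    cases v with
    | nil =>
      obtain ⟨z, hz, hz'⟩ := ih [] (by simp)
      exact ⟨z, ⟨z, hz, by simp⟩, hz'⟩
    | cons x v =>
      obtain ⟨z, hz, hz'⟩ := ih v (by simpa using hv)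
      refine ⟨z.flatMap (substLetter e x), ⟨z, hz, by cases x <;> simp⟩, ?_⟩
      rw [← chainGen_mk, hz', chainWord_cons]; rfl

/-- A test on words for essential positivity that avoids cyclic reduction: some rotation of the
reduced word `w` freely reduces to a coherent word. -/
def CoherentTest (w : List (Fin 2 × Bool)) : Prop :=
  ∃ k < (reduce w).length + 1, Coherent (reduce ((reduce w).drop k ++ (reduce w).take k))

theorem essPositive_mk_iff_coherentTest (w : List (Fin 2 × Bool)) :
    EssPositive (mk w) ↔ CoherentTest w := by
  constructor
  · intro h
    have hW := reduceCyclically.conj_conjugator_reduceCyclically (reduce w)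
    have hcr : IsCyclicallyReduced (reduceCyclically (reduce w)) :=
      reduceCyclically.isCyclicallyReduced (isReduced_toWord (x := mk w))
    have hc := (essPositive_mk_iff hcr).mp (h.of_isConj (isConj_mk_reduceCyclically (mk w)).symm)
    unfold CoherentTest
    generalize reduceCyclically (reduce w) = R at *
    generalize reduceCyclically.conjugator (reduce w) = C at *
    rw [← hW]
    -- the rotation by the conjugating word `C` moves `C` next to its inverse
    refine ⟨C.length, by simp, ?_⟩
    rw [List.append_assoc, List.drop_left, List.take_left, ← toWord_mk, ← mul_mk, ← mul_mk,
      ← inv_mk, inv_mul_cancel_right, hcr.isReduced.toWord_mk]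
    exact hc
  · rintro ⟨k, -, hk⟩
    refine (essPositive_of_coherent hk).of_isConj ?_
    rw [reduce.self]
    refine (isConj_mk_append _ _).trans ?_
    rw [List.take_append_drop, reduce.self]

theorem reduce_eq_foldr (w : List (Fin 2 × Bool)) :
    reduce w = w.foldr (fun x t => List.casesOn (motive := fun _ => List (Fin 2 × Bool)) t [x]
      fun y s => if x.1 = y.1 ∧ x.2 = !y.2 then s else x :: y :: s) [] := by
  induction w with
  | nil => rfl
  | cons x w ih => rw [reduce.cons, List.foldr_cons, ← ih]

theorem primrec_reduce : Primrec (reduce : List (Fin 2 × Bool) → List (Fin 2 × Bool)) := by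
  have hp : PrimrecPred fun q : (Fin 2 × Bool) × (Fin 2 × Bool) =>
      q.1.1 = q.2.1 ∧ q.1.2 = !q.2.2 := Primrec.primrecPred (Primrec.dom_finite _)
  refine (Primrec.list_foldr (f := id)
    (h := fun _ p => List.casesOn (motive := fun _ => List (Fin 2 × Bool)) p.2 [p.1]
      fun y s => if p.1.1 = y.1 ∧ p.1.2 = !y.2 then s else p.1 :: y :: s)
    Primrec.id (Primrec.const []) ?_).of_eq fun w => (reduce_eq_foldr w).symm
  refine Primrec.list_casesOn (α := List (Fin 2 × Bool) × (Fin 2 × Bool) × List (Fin 2 × Bool))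
    (f := fun q => q.2.2)
    (g := fun q => [q.2.1])
    (h := fun q r => if q.2.1.1 = r.1.1 ∧ q.2.1.2 = !r.1.2 then r.2 else q.2.1 :: r.1 :: r.2)
    (Primrec.snd.comp Primrec.snd)
    (Primrec.list_cons.comp (Primrec.fst.comp Primrec.snd) (Primrec.const [])) ?_
  have hx : Primrec fun q : ((List (Fin 2 × Bool)) × (Fin 2 × Bool) × List (Fin 2 × Bool)) ×
      ((Fin 2 × Bool) × List (Fin 2 × Bool)) => q.1.2.1 :=
    Primrec.fst.comp (Primrec.snd.comp Primrec.fst)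
  have hy : Primrec fun q : ((List (Fin 2 × Bool)) × (Fin 2 × Bool) × List (Fin 2 × Bool)) ×
      ((Fin 2 × Bool) × List (Fin 2 × Bool)) => q.2.1 := Primrec.fst.comp Primrec.snd
  have hs : Primrec fun q : ((List (Fin 2 × Bool)) × (Fin 2 × Bool) × List (Fin 2 × Bool)) ×
      ((Fin 2 × Bool) × List (Fin 2 × Bool)) => q.2.2 := Primrec.snd.comp Primrec.snd
  exact Primrec.ite (hp.comp (hx.pair hy)) hs
    (Primrec.list_cons.comp hx (Primrec.list_cons.comp hy hs))

theorem primrecPred_coherent : PrimrecPred Coherent := by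
  have hR : PrimrecRel fun x y : Fin 2 × Bool => x.1 = y.1 → x.2 = y.2 :=
    Primrec.primrecPred (Primrec.dom_finite _)
  have h1 : PrimrecRel fun (L : List (Fin 2 × Bool)) (y : Fin 2 × Bool) =>
      ∀ x ∈ L, x.1 = y.1 → x.2 = y.2 := hR.forall_mem_list
  have h2 : PrimrecRel fun (L M : List (Fin 2 × Bool)) =>
      ∀ y ∈ L, ∀ x ∈ M, x.1 = y.1 → x.2 = y.2 :=
    (PrimrecRel.swap h1).forall_mem_list
  exact (h2.comp Primrec.id Primrec.id).of_eq fun L =>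
    ⟨fun h x hx y hy => h y hy x hx, fun h y hy x hx => h x hx y hy⟩

theorem primrecPred_coherentTest : PrimrecPred CoherentTest := by
  have h : PrimrecRel fun (k : ℕ) (w : List (Fin 2 × Bool)) =>
      Coherent (reduce (w.drop k ++ w.take k)) :=
    primrecPred_coherent.comp (primrec_reduce.comp (Primrec.list_append.comp
      (Primrec.list_drop.comp Primrec.fst Primrec.snd)
      (Primrec.list_take.comp Primrec.fst Primrec.snd)))
  exact (h.exists_mem_list.comp (Primrec.list_range.comp
    (Primrec.succ.comp (Primrec.list_length.comp primrec_reduce))) primrec_reduce).of_eq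
    fun w => by simp [CoherentTest]

theorem primrec_expand (e : Bool) : Primrec (expand e) := by
  have hsub : ∀ x, Primrec fun w : List (Fin 2 × Bool) => w.flatMap (substLetter e x) := fun x =>
    Primrec.list_flatMap Primrec.id
      ((Primrec.dom_finite (substLetter e x)).comp Primrec.snd)
  refine Primrec.list_flatMap Primrec.id ?_
  have hw : Primrec fun q : List (List (Fin 2 × Bool)) × List (Fin 2 × Bool) => q.2 := Primrec.snd
  exact Primrec.list_cons.comp hw (Primrec.list_cons.comp ((hsub true).comp hw)
    (Primrec.list_cons.comp ((hsub false).comp hw) (Primrec.const [])))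

theorem primrecPred_exists_expand (e : Bool) : PrimrecPred fun w : List (Fin 2 × Bool) =>
    ∃ z ∈ (expand e)^[w.length + 1] [w], CoherentTest z := by
  refine primrecPred_coherentTest.exists_mem_list.comp ?_
  exact Primrec.nat_iterate (Primrec.succ.comp Primrec.list_length)
    (Primrec.list_cons.comp Primrec.id (Primrec.const []))
    ((primrec_expand e).comp Primrec.snd)

theorem length_reduceCyclically_le {α : Type*} [DecidableEq α] (L : List (α × Bool)) :
    (reduceCyclically L).length ≤ L.length := by
  have := congrArg List.length (reduceCyclically.conj_conjugator_reduceCyclically L)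
  simp only [List.length_append] at this
  omega

theorem cyclicLength_mk_le (w : List (Fin 2 × Bool)) : cyclicLength (mk w) ≤ w.length :=
  (length_reduceCyclically_le _).trans norm_mk_le

/-- The search that decides potential positivity. It uses the bound `‖u‖ + 1` on the length of the
chains, with the length of the given word in place of `‖u‖`. -/
theorem isPotentiallyPositive_mk_iff (w : List (Fin 2 × Bool)) :
    IsPotentiallyPositive (mk w) ↔
      (∃ z ∈ (expand true)^[w.length + 1] [w], CoherentTest z) ∨
        ∃ z ∈ (expand false)^[w.length + 1] [w], CoherentTest z := by
  constructor
  · intro h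
    obtain ⟨φ, hφ⟩ := h.exists_isPositive_map
    obtain ⟨e, v, hv, hp⟩ := exists_short_of_isPositive_map hφ
    have := cyclicLength_mk_le w
    obtain ⟨z, hz, hz'⟩ := exists_mem_expand e (w.length + 1) w v (by omega)
    rw [← hz', essPositive_mk_iff_coherentTest] at hp
    cases e
    · exact .inr ⟨z, hz, hp⟩
    · exact .inl ⟨z, hz, hp⟩
  · have main : ∀ e, (∃ z ∈ (expand e)^[w.length + 1] [w], CoherentTest z) →
        IsPotentiallyPositive (mk w) := by
      rintro e ⟨z, hz, hp⟩
      obtain ⟨v, hv⟩ := exists_chainWord_of_mem_expand e _ w z hz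
      rw [← essPositive_mk_iff_coherentTest, hv] at hp
      exact isPotentiallyPositive_of_essPositive hp
    rintro (h | h)
    · exact main _ h
    · exact main _ h

theorem computablePred_isPotentiallyPositive :
    ComputablePred fun w : List (Fin 2 × Bool) => IsPotentiallyPositive (mk w) := by
  have h : PrimrecPred fun w : List (Fin 2 × Bool) => IsPotentiallyPositive (mk w) :=
    ((primrecPred_exists_expand true).or (primrecPred_exists_expand false)).of_eq fun w =>
      (isPotentiallyPositive_mk_iff w).symm
  classical
  exact ⟨inferInstance, h.decide.to_comp⟩

end F2

/-- The set `Ω u` of chains is finite; if `[φ(u)]` is positive for some automorphism `φ`, then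
`[β ψ(u)]` is positive for some `ψ ∈ Ω u` and some `β` of type (W1) (and positivity of `[β ψ(u)]`
says that some inner automorphism takes `β ψ(u)` to a positive element); hence the finite search
over `Ω u` decides potential positivity, and potential positivity of the element of `F₂` given by
a word is decidable by an algorithm. -/
theorem mainTheorem1 :
    (∀ u : F2,
      (F2.Ω u).Finite ∧
      {β : MulAut F2 | F2.IsW1 β}.Finite ∧
      ((∃ φ : MulAut F2, (F2.cyclicWord (φ u)).IsPositive) →
        ∃ ψ ∈ F2.Ω u, ∃ β : MulAut F2, F2.IsW1 β ∧ (F2.cyclicWord (β (ψ u))).IsPositive) ∧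
      (∀ ψ ∈ F2.Ω u, ∀ β : MulAut F2, F2.IsW1 β →
        ((F2.cyclicWord (β (ψ u))).IsPositive ↔
          ∃ c : F2, F2.IsPositive (MulAut.conj c (β (ψ u))))) ∧
      (F2.IsPotentiallyPositive u ↔
        ∃ ψ ∈ F2.Ω u, ∃ β : MulAut F2, F2.IsW1 β ∧ (F2.cyclicWord (β (ψ u))).IsPositive)) ∧
    ComputablePred (fun w : List (Fin 2 × Bool) =>
      F2.IsPotentiallyPositive (FreeGroup.mk w)) := by
  refine ⟨fun u => ⟨F2.finite_Ω u, F2.finite_isW1, fun ⟨_, hφ⟩ =>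
    F2.exists_mem_Ω_of_isPositive_map hφ, fun ψ _ β _ => F2.cyclicWord_isPositive_iff _, ?_⟩,
    F2.computablePred_isPotentiallyPositive⟩
  constructor
  · intro h
    obtain ⟨φ, hφ⟩ := h.exists_isPositive_map
    exact F2.exists_mem_Ω_of_isPositive_map hφ
  · rintro ⟨ψ, -, h⟩
    exact F2.isPotentiallyPositive_of_essPositive h
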